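/- Let $N\ge 1$ and let $Q=(q_{ij})_{i,j=1}^N$ be a symmetric real matrix with $q_{ij}\in(-1,1)$; put $q=\max_{i,j}|q_{ij}|$. Let $\mathcal F_Q$ be the $Q$-deformed Fock space, the Hilbert space completion of the span of the elementary tensors $e_{\vec u}=e_{u_1}\otimes\cdots\otimes e_{u_n}$ ($n\ge 0$, $\vec u\in\{1,\dots,N\}^n$; the tensor of length $0$ is the vacuum $\Omega$) for the inner product $$\langle e_{\vec u},e_{\vec v}\rangle_Q=\delta_{m,n}\sum_{\sigma\in S_n}a(\sigma,\vec v)\prod_{k=1}^n\delta_{u_k,v_{\sigma^{-1}(k)}},\qquad a(\sigma,\vec v)=\prod_{a<b,\ \sigma(a)>\sigma(b)}q_{v_av_b},$$ where $m,n$ are the lengths of $\vec u,\vec v$. Let $l_ie_{\vec u}=e_i\otimes e_{\vec u}$ be the left creation operators, let $X_i=l_i+l_i^*$ be the mixed $q$-Gaussian variables, and let $\Xi_i$ be the bounded operator on $\mathcal F_Q$ with $\Xi_ie_{\vec u}=q_{iu_1}\cdots q_{iu_n}e_{\vec u}$. For words $\vec u,\vec v$ write $X_{\vec u}=X_{u_1}\cdots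 X_{u_n}$ and identify $a\otimes b^\circ$ with the Hilbert–Schmidt operator $\xi\mapsto\langle\xi,b^*\Omega\rangle_Q\,a\Omega$ (inner product linear in $\xi$). For a noncommutative power series $F=\sum_{\vec u,\vec v}a_{\vec u,\vec v}\,Y_{\vec u}\otimes Y_{\vec v}$ with complex coefficients let $\|F\|_r=\sum_{\vec u,\vec v}|a_{\vec u,\vec v}|\,r^{|\vec u|+|\vec v|}$; the radius of convergence of $F$ is the supremum of the $r$ with $\|F\|_r<\infty$. We say that $F$ represents an operator $T$ if $\sum_{\vec u,\vec v}a_{\vec u,\vec v}X_{\vec u}\otimes X_{\vec v}^\circ$ converges unconditionally to $T$ in the Hilbert–Schmidt norm. Suppose $\varepsilon>0$ and $q\bigl(3-2q+(3+\varepsilon)^2N^2\bigr)<1$, and let $R=\frac{2+\varepsilon}{1-q}$. Then for every $i=1,\dots,N$ we have $\|X_i\|<R$, and there is a noncommutative power series $F_i$ with radius of convergence greater than $R$ that represents $\Xi_i$ and satisfies $$\|F_i-1\otimes 1^\circ\|_R\le\frac{qN^2(3+\varepsilon)^2}{1-q\bigl(3-2q+(3+\varepsilon)^2N^2\bigr)}.$$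 -/

import Mathlib

noncomputable section

namespace MixedQGaussian

open scoped ENNReal Topology
open Filter

/-- A symmetric real matrix `Q = (q_ij)` with entries in `(-1, 1)`. -/
structure DeformationMatrix (N : ℕ) where
  coeff : Fin N → Fin N → ℝ
  symm : ∀ i j, coeff i j = coeff j i
  abs_lt_one : ∀ i j, |coeff i j| < 1

/-- Words `(i_1, ..., i_n)` of arbitrary length `n ≥ 0` in the letters `1, ..., N`. -/
abbrev Word (N : ℕ) : Type := Σ n : ℕ, (Fin n → Fin N)

variable {N : ℕ} (Q : DeformationMatrix N)

/-- The coefficient `a(σ, v)`: the product of `q(v_a, v_b)` over all inversions `a < b`,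
`σ b < σ a` of `σ`, equivalently the product of the factors picked up by the adjacent transpositions
in a reduced decomposition of `σ`. -/
def crossing {m n : ℕ} (v : Fin n → Fin N) (σ : Fin n ≃ Fin m) : ℝ :=
  ∏ a, ∏ b, if a < b ∧ σ b < σ a then Q.coeff (v a) (v b) else 1

/-- The number `⟨e_u, e_v⟩_Q`, where `u` and `v` have lengths `m` and `n`. It is a sum over bijections
`{1, ..., n} ≃ {1, ..., m}`: these are the permutations `σ` if `m = n`, and there are none (so the
value is `0`) if `m ≠ n`. A permutation contributes `a(σ, v)` if `u_k = v_{σ⁻¹ k}` for all `k`, and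
nothing otherwise. -/
def gram (u v : Word N) : ℝ :=
  ∑ σ : Fin v.1 ≃ Fin u.1, if ∀ k, u.2 (σ k) = v.2 k then crossing Q v.2 σ else 0

/-! Positivity of the form: `gram` is an explicit sum of rank one kernels. -/

theorem prod_pairs {n : ℕ} (f : Fin n → Fin n → ℝ) (hf : ∀ a, f a a = 1) :
    ∏ a, ∏ b, f a b = ∏ a, ∏ b, (if a < b then f a b * f b a else 1) := by
  have h1 : ∀ a b, f a b = (if a < b then f a b else 1) * (if b < a then f a b else 1) := by
    intro a b
    rcases lt_trichotomy a b with h | h | h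
    · simp [h, h.not_gt]
    · subst h; simp [hf]
    · simp [h, h.not_gt]
  calc ∏ a, ∏ b, f a b
      = (∏ a, ∏ b, (if a < b then f a b else 1)) * ∏ a, ∏ b, (if b < a then f a b else 1) := by
        simp only [← Finset.prod_mul_distrib]
        exact Finset.prod_congr rfl fun a _ => Finset.prod_congr rfl fun b _ => h1 a b
    _ = (∏ a, ∏ b, (if a < b then f a b else 1)) * ∏ a, ∏ b, (if a < b then f b a else 1) := by
        congr 1; exact Finset.prod_comm
    _ = _ := by
        simp only [← Finset.prod_mul_distrib]
        refine Finset.prod_congr rfl fun a _ => Finset.prod_congr rfl fun b _ => ?_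
        split_ifs <;> simp

/-- Whether `π` keeps the order of the pair `p` of letters. -/
def sgn {m n : ℕ} (π : Fin m ≃ Fin n) (p : Fin n × Fin n) : ℝ :=
  if π.symm p.1 < π.symm p.2 then 1 else -1

/-- Expanding each kernel `[[1, q], [q, 1]]` as `(1 + q) / 2 + (1 - q) / 2 * sgn * sgn`. -/
def weight {n : ℕ} (c : Fin n → Fin N) (S : Finset (Fin n × Fin n)) : ℝ :=
  (∏ p ∈ S, (if p.1 < p.2 then (1 - Q.coeff (c p.1) (c p.2)) / 2 else 0)) *
    ∏ p ∈ Finset.univ \ S, (if p.1 < p.2 then (1 + Q.coeff (c p.1) (c p.2)) / 2 else 1)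

theorem weight_nonneg {n : ℕ} (c : Fin n → Fin N) (S : Finset (Fin n × Fin n)) :
    0 ≤ weight Q c S := by
  refine mul_nonneg (Finset.prod_nonneg fun p _ => ?_) (Finset.prod_nonneg fun p _ => ?_)
  · have := abs_lt.1 (Q.abs_lt_one (c p.1) (c p.2))
    split_ifs <;> linarith
  · have := abs_lt.1 (Q.abs_lt_one (c p.1) (c p.2))
    split_ifs <;> linarith

theorem crossing_eq {l m n : ℕ} (c : Fin n → Fin N) (π : Fin l ≃ Fin n) (π' : Fin m ≃ Fin n) :
    crossing Q (c ∘ π') (π'.trans π.symm) =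
      ∑ S : Finset (Fin n × Fin n),
        weight Q c S * (∏ p ∈ S, sgn π p) * (∏ p ∈ S, sgn π' p) := by
  have h1 : crossing Q (c ∘ π') (π'.trans π.symm) = ∏ a, ∏ b,
      if π'.symm a < π'.symm b ∧ π.symm b < π.symm a then Q.coeff (c a) (c b) else 1 := by
    unfold crossing
    rw [← Equiv.prod_comp π'.symm]
    refine Finset.prod_congr rfl fun a _ => ?_
    rw [← Equiv.prod_comp π'.symm]
    simp
  have h2 : crossing Q (c ∘ π') (π'.trans π.symm) = ∏ p : Fin n × Fin n,
      ((if p.1 < p.2 then (1 - Q.coeff (c p.1) (c p.2)) / 2 else 0) * (sgn π p * sgn π' p) +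
        (if p.1 < p.2 then (1 + Q.coeff (c p.1) (c p.2)) / 2 else 1)) := by
    rw [h1, prod_pairs, Fintype.prod_prod_type]
    · refine Finset.prod_congr rfl fun a _ => Finset.prod_congr rfl fun b _ => ?_
      by_cases hab : a < b
      · have e1 : π.symm a ≠ π.symm b := fun h => hab.ne (π.symm.injective h)
        have e2 : π'.symm a ≠ π'.symm b := fun h => hab.ne (π'.symm.injective h)
        rw [Q.symm (c b) (c a)]
        simp only [sgn, hab, if_true]
        rcases e1.lt_or_gt with h | h <;> rcases e2.lt_or_gt with h' | h' <;>
          simp only [h, h', h.not_gt, h'.not_gt, and_true, and_false, and_self, if_true, if_false] <;> ring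
      · simp [hab]
    · simp
  rw [h2, Finset.prod_add]
  simp only [Finset.powerset_univ]
  refine Finset.sum_congr rfl fun S _ => ?_
  rw [Finset.prod_mul_distrib, Finset.prod_mul_distrib]
  unfold weight; ring

/-- The feature vectors of the rank one decomposition of `gram`. -/
def feature {n : ℕ} (c : Fin n → Fin N) (S : Finset (Fin n × Fin n)) (u : Word N) : ℝ :=
  ∑ π : Fin u.1 ≃ Fin n, if ∀ k, c (π k) = u.2 k then ∏ p ∈ S, sgn π p else 0

theorem feature_eq_zero {n : ℕ} (c : Fin n → Fin N) (S : Finset (Fin n × Fin n)) (u : Word N)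
    (h : u.1 ≠ n) : feature c S u = 0 := by
  have : IsEmpty (Fin u.1 ≃ Fin n) := ⟨fun e => h (by simpa using Fintype.card_congr e)⟩
  simp [feature]

theorem sum_feature (u v : Word N) :
    ∑ c : Fin u.1 → Fin N, ∑ S, weight Q c S * feature c S u * feature c S v =
      (u.1.factorial : ℝ) * gram Q u v := by
  have h1 : ∀ c : Fin u.1 → Fin N, ∑ S, weight Q c S * feature c S u * feature c S v =
      ∑ π : Fin u.1 ≃ Fin u.1, ∑ π' : Fin v.1 ≃ Fin u.1,
        if ∀ k, c (π k) = u.2 k then (if ∀ k, c (π' k) = v.2 k then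
          crossing Q (c ∘ π') (π'.trans π.symm) else 0) else 0 := by
    intro c
    have h0 : ∀ S, weight Q c S * feature c S u * feature c S v =
        ∑ π : Fin u.1 ≃ Fin u.1, ∑ π' : Fin v.1 ≃ Fin u.1,
          weight Q c S * ((if ∀ k, c (π k) = u.2 k then ∏ p ∈ S, sgn π p else 0) *
            (if ∀ k, c (π' k) = v.2 k then ∏ p ∈ S, sgn π' p else 0)) := by
      intro S
      rw [mul_assoc, feature, feature, Fintype.sum_mul_sum, Finset.mul_sum]
      exact Finset.sum_congr rfl fun π _ => Finset.mul_sum _ _ _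
    simp only [h0]
    rw [Finset.sum_comm]
    refine Finset.sum_congr rfl fun π _ => ?_
    rw [Finset.sum_comm]
    refine Finset.sum_congr rfl fun π' _ => ?_
    rw [crossing_eq]
    split_ifs <;> simp [mul_assoc]
  simp_rw [h1]
  rw [Finset.sum_comm]
  have h2 : ∀ π : Fin u.1 ≃ Fin u.1, ∑ c : Fin u.1 → Fin N, ∑ π' : Fin v.1 ≃ Fin u.1,
        (if ∀ k, c (π k) = u.2 k then (if ∀ k, c (π' k) = v.2 k then
          crossing Q (c ∘ π') (π'.trans π.symm) else 0) else 0) = gram Q u v := by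
    intro π
    have hc : ∀ c : Fin u.1 → Fin N, (∀ k, c (π k) = u.2 k) ↔ c = u.2 ∘ π.symm := by
      intro c
      constructor
      · intro h; funext k; simpa using h (π.symm k)
      · rintro rfl k; simp
    rw [Finset.sum_comm]
    simp only [hc, Finset.sum_ite_eq', Finset.mem_univ, if_true]
    unfold gram
    refine Fintype.sum_equiv (Equiv.equivCongr (Equiv.refl _) π.symm) _ _ fun π' => ?_
    have : ∀ k, (Equiv.equivCongr (Equiv.refl (Fin v.1)) π.symm) π' k = π.symm (π' k) := by
      intro k; simp [Equiv.equivCongr]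
    simp only [this, Function.comp_apply]
    split_ifs with h
    · have e1 : (u.2 ∘ π.symm) ∘ π' = v.2 := funext h
      have e2 : (Equiv.equivCongr (Equiv.refl (Fin v.1)) π.symm) π' = π'.trans π.symm := by
        ext k; simp
      rw [e1, e2]
    · rfl
  simp_rw [h2]
  simp [Finset.card_univ, Fintype.card_equiv (Equiv.refl (Fin u.1))]

theorem gram_eq_zero (u v : Word N) (h : u.1 ≠ v.1) : gram Q u v = 0 := by
  have : IsEmpty (Fin v.1 ≃ Fin u.1) := ⟨fun e => h (by simpa using (Fintype.card_congr e).symm)⟩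
  simp [gram]

theorem gram_eq (M : ℕ) (u v : Word N) (hu : u.1 < M) :
    gram Q u v = ∑ n ∈ Finset.range M, ∑ c : Fin n → Fin N, ∑ S,
      (n.factorial : ℝ)⁻¹ * weight Q c S * (feature c S u * feature c S v) := by
  rw [Finset.sum_eq_single u.1]
  · have h := sum_feature Q u v
    have h0 : (u.1.factorial : ℝ) ≠ 0 := by positivity
    simp only [mul_assoc, ← Finset.mul_sum] at h ⊢
    rw [h]; field_simp
  · intro n _ hn
    simp [feature_eq_zero _ _ u hn.symm]
  · intro h; simp [hu] at h

theorem gram_symm (u v : Word N) : gram Q u v = gram Q v u := by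
  rw [gram_eq Q (max u.1 v.1 + 1) u v (by omega), gram_eq Q (max u.1 v.1 + 1) v u (by omega)]
  simp only [mul_comm (feature _ _ u)]

/-! The recursion for `gram` that makes creation and annihilation adjoint to each other. -/

theorem gram_cons_zero (i : Fin N) {m : ℕ} (u : Fin m → Fin N) (v : Fin 0 → Fin N) :
    gram Q ⟨m + 1, Fin.cons i u⟩ ⟨0, v⟩ = 0 := gram_eq_zero _ _ _ (by simp)

/-- The bijection that sends `p.1` to `0` and acts on the other positions as `p.2`. -/
def insertEquiv {m n : ℕ} (p : Fin (n + 1) × (Fin n ≃ Fin m)) : Fin (n + 1) ≃ Fin (m + 1) :=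
  (finSuccEquiv' p.1).trans ((Equiv.optionCongr p.2).trans (finSuccEquiv' 0).symm)

theorem insertEquiv_at {m n : ℕ} (p : Fin (n + 1) × (Fin n ≃ Fin m)) :
    insertEquiv p p.1 = 0 := by simp [insertEquiv]

theorem insertEquiv_succAbove {m n : ℕ} (p : Fin (n + 1) × (Fin n ≃ Fin m)) (j : Fin n) :
    insertEquiv p (p.1.succAbove j) = (p.2 j).succ := by simp [insertEquiv]

theorem insertEquiv_bijective (m n : ℕ) :
    Function.Bijective (insertEquiv : Fin (n + 1) × (Fin n ≃ Fin m) → _) := by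
  constructor
  · rintro ⟨k, τ⟩ ⟨k', τ'⟩ h
    have hk : k = k' := by
      apply (insertEquiv (k, τ)).injective
      rw [insertEquiv_at (k, τ), h, insertEquiv_at (k', τ')]
    subst hk
    congr 1
    ext j
    have := congrArg (fun e => e (k.succAbove j)) h
    simp only [insertEquiv_succAbove (k, τ), insertEquiv_succAbove (k, τ')] at this
    rw [Fin.succ_injective _ this]
  · intro σ
    set k := σ.symm 0 with hk
    set e : Option (Fin n) ≃ Option (Fin m) :=
      (finSuccEquiv' k).symm.trans (σ.trans (finSuccEquiv' 0)) with he
    have hn : e none = none := by simp [he, hk]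
    refine ⟨(k, e.removeNone), ?_⟩
    ext x : 1
    refine Fin.succAboveCases k ?_ (fun j => ?_) x
    · rw [insertEquiv_at (k, e.removeNone)]; simp [hk]
    · rw [insertEquiv_succAbove (k, e.removeNone)]
      have h1 : e (some j) ≠ none := fun h => by simpa using e.injective (h.trans hn.symm)
      obtain ⟨y, hy⟩ := Option.ne_none_iff_exists'.1 h1
      have h2 := Equiv.removeNone_some e ⟨y, hy⟩
      rw [hy] at h2
      rw [Option.some.inj h2]
      have h3 : (finSuccEquiv' 0) (σ (k.succAbove j)) = some y := by simpa [he] using hy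
      rw [← Fin.succAbove_zero, ← finSuccEquiv'_eq_some.1 h3]

theorem crossing_insert {m n : ℕ} (v : Fin (n + 1) → Fin N) (k : Fin (n + 1))
    (τ : Fin n ≃ Fin m) :
    crossing Q v (insertEquiv (k, τ)) =
      (∏ a, if a < k then Q.coeff (v k) (v a) else 1) * crossing Q (k.removeNth v) τ := by
  unfold crossing
  have hk := insertEquiv_at (k, τ)
  have hs := insertEquiv_succAbove (k, τ)
  simp only at hk hs
  simp only [Fin.prod_univ_succAbove _ k, hk, hs, Fin.not_lt_zero, lt_irrefl, Fin.succ_pos,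
    and_true, and_false, if_false, Finset.prod_const_one, one_mul, Finset.prod_mul_distrib,
    Fin.succ_lt_succ_iff, Fin.succAbove_lt_succAbove_iff, Fin.removeNth, Q.symm (v k)]

theorem gram_cons_succ (i : Fin N) {m n : ℕ} (u : Fin m → Fin N) (v : Fin (n + 1) → Fin N) :
    gram Q ⟨m + 1, Fin.cons i u⟩ ⟨n + 1, v⟩ =
      ∑ k, (if v k = i then ∏ a, (if a < k then Q.coeff i (v a) else 1) else 0) *
        gram Q ⟨m, u⟩ ⟨n, k.removeNth v⟩ := by
  unfold gram
  rw [← (insertEquiv_bijective m n).sum_comp, Fintype.sum_prod_type]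
  refine Finset.sum_congr rfl fun k _ => ?_
  rw [Finset.mul_sum]
  refine Finset.sum_congr rfl fun τ _ => ?_
  have hk := insertEquiv_at (k, τ)
  have hs := insertEquiv_succAbove (k, τ)
  simp only at hk hs
  simp only [Fin.forall_iff_succAbove k, hk, hs, Fin.cons_zero, Fin.cons_succ, crossing_insert,
    Fin.removeNth]
  by_cases h : v k = i
  · subst h
    by_cases h2 : ∀ j, u (τ j) = v (k.succAbove j)
    · simp [h2]
    · simp [h2]
  · simp [h, Ne.symm h]

/-- The algebraic Fock space: finite linear combinations of elementary tensors `e_u`. -/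
def PreFock {N : ℕ} (_ : DeformationMatrix N) : Type := Word N →₀ ℂ

instance : AddCommGroup (PreFock Q) := inferInstanceAs (AddCommGroup (Word N →₀ ℂ))
instance : Module ℂ (PreFock Q) := inferInstanceAs (Module ℂ (Word N →₀ ℂ))

/-- The elementary tensor `e_{u_1} ⊗ ... ⊗ e_{u_n}`. -/
def PreFock.basis (u : Word N) : PreFock Q := Finsupp.single u 1

/-- The form `⟨x, y⟩_Q`, conjugate linear in the first variable. -/
def fockForm (x y : Word N →₀ ℂ) : ℂ :=
  x.sum fun u a => y.sum fun v b => (starRingEnd ℂ) a * b * (gram Q u v : ℂ)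

theorem fockForm_add_left (x y z : Word N →₀ ℂ) :
    fockForm Q (x + y) z = fockForm Q x z + fockForm Q y z := by
  unfold fockForm
  refine Finsupp.sum_add_index' (fun u => by simp) fun u a b => ?_
  simp [add_mul, Finsupp.sum]
  rw [Finset.sum_add_distrib]

theorem fockForm_smul_left (x y : Word N →₀ ℂ) (r : ℂ) :
    fockForm Q (r • x) y = (starRingEnd ℂ) r * fockForm Q x y := by
  unfold fockForm
  rw [Finsupp.sum_smul_index' (fun u => by simp)]
  simp [Finsupp.sum, Finset.mul_sum, mul_assoc]

theorem fockForm_conj (x y : Word N →₀ ℂ) :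
    (starRingEnd ℂ) (fockForm Q y x) = fockForm Q x y := by
  unfold fockForm Finsupp.sum
  simp only [map_sum, map_mul, Complex.conj_conj, Complex.conj_ofReal]
  rw [Finset.sum_comm]
  refine Finset.sum_congr rfl fun u _ => Finset.sum_congr rfl fun v _ => ?_
  rw [gram_symm]; ring

theorem fockForm_nonneg (x : Word N →₀ ℂ) : 0 ≤ (fockForm Q x x).re := by
  set M : ℕ := x.support.sup (fun u => u.1) + 1 with hM
  set T : Finset (Σ n : ℕ, (Fin n → Fin N) × Finset (Fin n × Fin n)) :=
    (Finset.range M).sigma fun n => Finset.univ with hT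
  have hg : ∀ u ∈ x.support, ∀ v, gram Q u v = ∑ t ∈ T,
      ((t.1.factorial : ℝ)⁻¹ * weight Q t.2.1 t.2.2) *
        (feature t.2.1 t.2.2 u * feature t.2.1 t.2.2 v) := by
    intro u hu v
    rw [gram_eq Q M u v (Nat.lt_succ_of_le (Finset.le_sup (f := fun u : Word N => u.1) hu)),
      hT, Finset.sum_sigma]
    refine Finset.sum_congr rfl fun n _ => ?_
    rw [Fintype.sum_prod_type]
  have hx : fockForm Q x x = ∑ t ∈ T,
      ((((t.1.factorial : ℝ)⁻¹ * weight Q t.2.1 t.2.2 *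
        Complex.normSq (∑ u ∈ x.support, x u * (feature t.2.1 t.2.2 u : ℂ)) : ℝ)) : ℂ) := by
    have h1 : fockForm Q x x = ∑ u ∈ x.support, ∑ v ∈ x.support, ∑ t ∈ T,
        (((t.1.factorial : ℝ)⁻¹ * weight Q t.2.1 t.2.2 : ℝ) : ℂ) *
          ((starRingEnd ℂ) (x u * (feature t.2.1 t.2.2 u : ℂ)) *
            (x v * (feature t.2.1 t.2.2 v : ℂ))) := by
      unfold fockForm Finsupp.sum
      refine Finset.sum_congr rfl fun u hu => Finset.sum_congr rfl fun v _ => ?_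
      beta_reduce
      rw [hg u hu v, Complex.ofReal_sum, Finset.mul_sum]
      refine Finset.sum_congr rfl fun t _ => ?_
      simp only [map_mul, Complex.conj_ofReal]
      push_cast
      ring
    rw [h1]
    simp_rw [Finset.sum_comm (s := x.support) (t := T)]
    refine Finset.sum_congr rfl fun t _ => ?_
    rw [Complex.ofReal_mul _ (Complex.normSq _), ← Complex.mul_conj,
      mul_comm (∑ u ∈ x.support, _), map_sum, Finset.sum_mul_sum, Finset.mul_sum]
    simp only [Finset.mul_sum]
  rw [hx, ← Complex.ofReal_sum, Complex.ofReal_re]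
  refine Finset.sum_nonneg fun t _ => mul_nonneg (mul_nonneg (by positivity)
    (weight_nonneg Q _ _)) (Complex.normSq_nonneg _)

abbrev fockCore : PreInnerProductSpace.Core ℂ (PreFock Q) where
  inner := fockForm Q
  conj_inner_symm := fockForm_conj Q
  re_inner_nonneg := fockForm_nonneg Q
  add_left := fockForm_add_left Q
  smul_left := fockForm_smul_left Q

instance : SeminormedAddCommGroup (PreFock Q) :=
  @InnerProductSpace.Core.toSeminormedAddCommGroup ℂ (PreFock Q) _ _ _ (fockCore Q)

instance : InnerProductSpace ℂ (PreFock Q) := InnerProductSpace.ofCore (fockCore Q)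

@[elab_as_elim]
theorem PreFock.induction {Q : DeformationMatrix N} {p : PreFock Q → Prop} (x : PreFock Q) (h0 : p 0)
    (hadd : ∀ x y, p x → p y → p (x + y)) (hs : ∀ (a : ℂ) u, p (a • PreFock.basis Q u)) : p x := by
  refine Finsupp.induction_linear (motive := p) x h0 hadd fun u a => ?_
  have : (Finsupp.single u a : Word N →₀ ℂ) = a • Finsupp.single u 1 := by simp
  exact this ▸ hs a u

/-- Linear extension of a map given on elementary tensors. -/
def PreFock.lift {Q : DeformationMatrix N} {V : Type*} [AddCommGroup V] [Module ℂ V] (f : Word N → V) :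
    PreFock Q →ₗ[ℂ] V := (Finsupp.linearCombination ℂ f : (Word N →₀ ℂ) →ₗ[ℂ] V)

@[simp] theorem PreFock.lift_basis {V : Type*} [AddCommGroup V] [Module ℂ V] (f : Word N → V)
    (u : Word N) : PreFock.lift f (PreFock.basis Q u) = f u := by
  exact (Finsupp.linearCombination_single ℂ (1 : ℂ) u).trans (one_smul _ _)

@[simp] theorem inner_basis (u v : Word N) :
    inner ℂ (PreFock.basis Q u) (PreFock.basis Q v) = (gram Q u v : ℂ) := by
  change fockForm Q (Finsupp.single u 1) (Finsupp.single v 1) = _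
  simp [fockForm]

/-- `l_i (e_u) = e_i ⊗ e_u` on the algebraic Fock space. -/
def preCreation (i : Fin N) : PreFock Q →ₗ[ℂ] PreFock Q :=
  PreFock.lift fun u => PreFock.basis Q ⟨u.1 + 1, Fin.cons i u.2⟩

/-- `l_i^* (e_v) = ∑_k δ_{i, v_k} q_{i v_1} ⋯ q_{i v_{k-1}} e_{v with v_k removed}`. -/
def annihilateWord (i : Fin N) : Word N → PreFock Q
  | ⟨0, _⟩ => 0
  | ⟨n + 1, v⟩ => ∑ k,
      ((if v k = i then ∏ a, (if a < k then Q.coeff i (v a) else 1) else 0 : ℝ) : ℂ) •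
        PreFock.basis Q ⟨n, k.removeNth v⟩

/-- `l_i^*` on the algebraic Fock space. -/
def preAnnihilation (i : Fin N) : PreFock Q →ₗ[ℂ] PreFock Q :=
  PreFock.lift (annihilateWord Q i)

theorem inner_preCreation_left (i : Fin N) (x y : PreFock Q) :
    inner ℂ (preCreation Q i x) y = inner ℂ x (preAnnihilation Q i y) := by
  refine PreFock.induction x (by simp) (fun x x' h h' => by simp [inner_add_left, h, h']) fun a u => ?_
  refine PreFock.induction y (by simp) (fun y y' h h' => by rw [map_add, inner_add_right, inner_add_right, h, h']) fun b v => ?_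
  simp only [map_smul, inner_smul_left, inner_smul_right]
  congr 2
  obtain ⟨m, u⟩ := u
  obtain ⟨n, v⟩ := v
  simp only [preCreation, preAnnihilation, PreFock.lift_basis, inner_basis]
  cases n with
  | zero => simp [annihilateWord, gram_cons_zero]
  | succ n =>
    rw [gram_cons_succ]
    simp only [annihilateWord, inner_sum, inner_smul_right, inner_basis, Complex.ofReal_sum,
      Complex.ofReal_mul]

/-- The commutation relation `l_i^* l_j - q_ij l_j l_i^* = δ_ij`. -/
theorem annihilation_creation (i j : Fin N) (x : PreFock Q) :
    preAnnihilation Q i (preCreation Q j x) =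
      (if i = j then x else 0) + (Q.coeff i j : ℂ) • preCreation Q j (preAnnihilation Q i x) := by
  refine PreFock.induction x (by simp) (fun x y h h' => ?_) fun a u => ?_
  · simp only [map_add, h, h', smul_add]
    split_ifs <;> abel
  · simp only [map_smul]
    rw [smul_comm _ a, ← smul_ite_zero, ← smul_add]
    congr 1
    obtain ⟨m, u⟩ := u
    simp only [preCreation, preAnnihilation, PreFock.lift_basis, annihilateWord]
    rw [Fin.sum_univ_succ]
    congr 1
    · by_cases h : i = j
      · subst h; simp [Fin.removeNth_zero]
      · simp [h, Ne.symm h]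
    · cases m with
      | zero => simp
      | succ m =>
        simp only [map_sum, map_smul, PreFock.lift_basis, Finset.smul_sum, smul_smul]
        refine Finset.sum_congr rfl fun k _ => ?_
        congr 1
        · by_cases h : u k = i
          · simp only [Fin.cons_succ, h, if_true, Fin.prod_univ_succ (n := m + 1), Fin.succ_pos,
              Fin.cons_zero, Fin.succ_lt_succ_iff, Complex.ofReal_mul]
          · simp [h]
        · congr 2
          funext a
          refine Fin.cases ?_ (fun a => ?_) a <;> simp [Fin.removeNth]

/-- The span of the elementary tensors of length at most `n`. -/
def ShortWords {Q : DeformationMatrix N} (n : ℕ) : Submodule ℂ (PreFock Q) :=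
  Submodule.span ℂ (PreFock.basis Q '' {u | u.1 ≤ n})

theorem mem_shortWords (x : PreFock Q) : ∃ n, x ∈ ShortWords (Q := Q) n := by
  have mono : ∀ m n, m ≤ n → ShortWords (Q := Q) m ≤ ShortWords n := fun m n h =>
    Submodule.span_mono (Set.image_mono fun u hu => le_trans hu h)
  refine PreFock.induction x ⟨0, zero_mem _⟩ ?_ fun a u => ?_
  · rintro x y ⟨m, hm⟩ ⟨n, hn⟩
    exact ⟨max m n, add_mem (mono _ _ (le_max_left _ _) hm) (mono _ _ (le_max_right _ _) hn)⟩
  · exact ⟨u.1, Submodule.smul_mem _ _ (Submodule.subset_span ⟨u, le_refl u.1, rfl⟩)⟩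

theorem annihilation_shortWords (i : Fin N) (n : ℕ) (x : PreFock Q)
    (hx : x ∈ ShortWords (Q := Q) n) :
    (n = 0 → preAnnihilation Q i x = 0) ∧
      (preAnnihilation Q i x ∈ ShortWords (Q := Q) (n - 1)) := by
  induction hx using Submodule.span_induction with
  | zero => simp
  | add x y _ _ h h' =>
    exact ⟨fun h0 => by rw [map_add, h.1 h0, h'.1 h0, add_zero],
      by rw [map_add]; exact add_mem h.2 h'.2⟩
  | smul a x _ h =>
    exact ⟨fun h0 => by rw [map_smul, h.1 h0, smul_zero],
      by rw [map_smul]; exact Submodule.smul_mem _ _ h.2⟩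
  | mem x h =>
    obtain ⟨⟨m, u⟩, hu, rfl⟩ := h
    simp only [preAnnihilation, PreFock.lift_basis]
    cases m with
    | zero => simp [annihilateWord]
    | succ m =>
      have hu' : m + 1 ≤ n := hu
      refine ⟨fun h => by omega, ?_⟩
      refine Submodule.sum_mem _ fun k _ => Submodule.smul_mem _ _ (Submodule.subset_span
        ⟨_, ?_, rfl⟩)
      change m ≤ n - 1
      omega

theorem norm_preCreation_sq_le (i : Fin N) (x : PreFock Q) :
    ‖preCreation Q i x‖ ^ 2 ≤ (1 - |Q.coeff i i|)⁻¹ * ‖x‖ ^ 2 := by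
  have hq := Q.abs_lt_one i i
  set C := (1 - |Q.coeff i i|)⁻¹ with hC
  have hC0 : 0 < C := inv_pos.2 (by linarith)
  have hC1 : 1 + |Q.coeff i i| * C = C := by
    rw [hC]; field_simp [show (1 - |Q.coeff i i|) ≠ 0 by linarith]; ring
  have key : ∀ x : PreFock Q, ‖preCreation Q i x‖ ^ 2 =
      ‖x‖ ^ 2 + Q.coeff i i * ‖preAnnihilation Q i x‖ ^ 2 := by
    intro x
    have h : inner ℂ (preCreation Q i x) (preCreation Q i x) =
        inner ℂ x x + (Q.coeff i i : ℂ) *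
          inner ℂ (preAnnihilation Q i x) (preAnnihilation Q i x) := by
      rw [inner_preCreation_left, annihilation_creation, if_pos rfl, inner_add_right,
        inner_smul_right,
        ← inner_conj_symm x (preCreation Q i (preAnnihilation Q i x)), inner_preCreation_left,
        inner_conj_symm]
    rw [inner_self_eq_norm_sq_to_K, inner_self_eq_norm_sq_to_K, inner_self_eq_norm_sq_to_K] at h
    have h' := congrArg Complex.re h
    simpa [← Complex.ofReal_pow, ← Complex.ofReal_mul] using h'
  have main : ∀ n, ∀ x ∈ ShortWords (Q := Q) n, ‖preCreation Q i x‖ ^ 2 ≤ C * ‖x‖ ^ 2 := by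
    intro n
    induction n with
    | zero =>
      intro x hx
      rw [key, (annihilation_shortWords Q i 0 x hx).1 rfl]
      have h1 : 1 ≤ C := by nlinarith [mul_nonneg (abs_nonneg (Q.coeff i i)) hC0.le]
      rw [norm_zero]
      nlinarith [sq_nonneg ‖x‖]
    | succ n ih =>
      intro x hx
      set y := preAnnihilation Q i x with hy
      have hyn : y ∈ ShortWords (Q := Q) n := (annihilation_shortWords Q i _ x hx).2
      have h1 : ‖y‖ ^ 2 ≤ ‖preCreation Q i y‖ * ‖x‖ := by
        have h : inner ℂ y y = inner ℂ (preCreation Q i y) x := by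
          rw [inner_preCreation_left]
        have h2 := norm_inner_le_norm (𝕜 := ℂ) (preCreation Q i y) x
        rw [← h, inner_self_eq_norm_sq_to_K] at h2
        simpa using h2
      have h2 := ih y hyn
      have h3 : ‖y‖ ^ 2 ≤ C * ‖x‖ ^ 2 := by
        by_cases h0 : ‖y‖ = 0
        · rw [h0]; nlinarith [mul_nonneg hC0.le (sq_nonneg ‖x‖)]
        · have : 0 < ‖y‖ ^ 2 := by positivity
          have h4 : (‖y‖ ^ 2) * ‖y‖ ^ 2 ≤ (C * ‖x‖ ^ 2) * ‖y‖ ^ 2 := by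
            calc (‖y‖ ^ 2) * ‖y‖ ^ 2 ≤ (‖preCreation Q i y‖ * ‖x‖) * (‖preCreation Q i y‖ * ‖x‖) :=
                  mul_self_le_mul_self (by positivity) h1
              _ = ‖preCreation Q i y‖ ^ 2 * ‖x‖ ^ 2 := by ring
              _ ≤ (C * ‖y‖ ^ 2) * ‖x‖ ^ 2 := by gcongr
              _ = _ := by ring
          exact le_of_mul_le_mul_right h4 this
      rw [key]
      calc ‖x‖ ^ 2 + Q.coeff i i * ‖y‖ ^ 2 ≤ ‖x‖ ^ 2 + |Q.coeff i i| * (C * ‖x‖ ^ 2) := by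
            gcongr; exact le_abs_self _
        _ = (1 + |Q.coeff i i| * C) * ‖x‖ ^ 2 := by ring
        _ = C * ‖x‖ ^ 2 := by rw [hC1]
  obtain ⟨n, hn⟩ := mem_shortWords Q x
  exact main n x hn

/-- `q_i(u) = q_{i u_1} ⋯ q_{i u_n}`. -/
def letterWeight (i : Fin N) (u : Word N) : ℝ := ∏ k, Q.coeff i (u.2 k)

theorem letterWeight_eq (i : Fin N) (u v : Word N) (h : gram Q u v ≠ 0) :
    letterWeight Q i u = letterWeight Q i v := by
  obtain ⟨σ, -, hσ⟩ := Finset.exists_ne_zero_of_sum_ne_zero h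
  have h1 : ∀ k, u.2 (σ k) = v.2 k := by by_contra hc; exact hσ (if_neg hc)
  unfold letterWeight
  rw [← Equiv.prod_comp σ]
  simp [h1]

/-- `Ξ_i` on the algebraic Fock space. -/
def preMultiplier (i : Fin N) : PreFock Q →ₗ[ℂ] PreFock Q :=
  PreFock.lift fun u => (letterWeight Q i u : ℂ) • PreFock.basis Q u

theorem norm_preMultiplier_le (i : Fin N) (x : PreFock Q) : ‖preMultiplier Q i x‖ ≤ ‖x‖ := by
  have habs : ∀ u, letterWeight Q i u ^ 2 ≤ 1 := by
    intro u
    rw [letterWeight, ← Finset.prod_pow]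
    refine Finset.prod_le_one (fun k _ => sq_nonneg _) fun k _ => ?_
    exact (sq_le_one_iff_abs_le_one _).2 (Q.abs_lt_one _ _).le
  let D : PreFock Q →ₗ[ℂ] PreFock Q :=
    PreFock.lift fun u => (Real.sqrt (1 - letterWeight Q i u ^ 2) : ℂ) • PreFock.basis Q u
  have key : ∀ x y : PreFock Q, inner ℂ x y =
      inner ℂ (preMultiplier Q i x) (preMultiplier Q i y) + inner ℂ (D x) (D y) := by
    intro x y
    refine PreFock.induction x (by simp) (fun x x' h h' => ?_) fun a u => ?_
    · simp only [map_add, inner_add_left, h, h']; ring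
    refine PreFock.induction y (by simp) (fun y y' h h' => ?_) fun b v => ?_
    · rw [inner_add_right, h, h', map_add, map_add, inner_add_right, inner_add_right]; ring
    simp only [preMultiplier, D, map_smul, PreFock.lift_basis, inner_smul_left, inner_smul_right,
      inner_basis, Complex.conj_ofReal]
    by_cases hg : gram Q u v = 0
    · simp [hg]
    · rw [letterWeight_eq Q i u v hg]
      have h1 : ((Real.sqrt (1 - letterWeight Q i v ^ 2) : ℝ) : ℂ) *
          (Real.sqrt (1 - letterWeight Q i v ^ 2) : ℝ) =
          1 - (letterWeight Q i v : ℂ) * (letterWeight Q i v : ℂ) := by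
        rw [← Complex.ofReal_mul, Real.mul_self_sqrt (by linarith [habs v])]
        push_cast; ring
      linear_combination (-(starRingEnd ℂ) a * b * gram Q u v) * h1
  have h := key x x
  rw [inner_self_eq_norm_sq_to_K, inner_self_eq_norm_sq_to_K, inner_self_eq_norm_sq_to_K] at h
  have h' : ‖x‖ ^ 2 = ‖preMultiplier Q i x‖ ^ 2 + ‖D x‖ ^ 2 := by exact_mod_cast h
  exact le_of_sq_le_sq (by nlinarith [sq_nonneg ‖D x‖]) (norm_nonneg _)

/-- The Fock space `F_Q`: the Hilbert space completion of the algebraic Fock space. (For `|q_ij| < 1`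
the form is positive definite, so that no vectors are identified.) -/
abbrev Fock {N : ℕ} (Q : DeformationMatrix N) : Type := UniformSpace.Completion (PreFock Q)

/-- The elementary tensor `e_u` in `F_Q`. -/
def tensor (u : Word N) : Fock Q := (PreFock.basis Q u : Fock Q)

/-- The vacuum vector `Ω`. -/
def vacuum : Fock Q := tensor Q ⟨0, Fin.elim0⟩

/-- The left creation operator `l_i`, with `l_i (e_u) = e_i ⊗ e_u`. -/
def creation (i : Fin N) : Fock Q →L[ℂ] Fock Q :=
  ((preCreation Q i).mkContinuous (Real.sqrt (1 - |Q.coeff i i|)⁻¹) fun x => by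
    refine le_of_sq_le_sq ?_ (by positivity)
    rw [mul_pow, Real.sq_sqrt (inv_nonneg.2 (by linarith [Q.abs_lt_one i i]))]
    exact norm_preCreation_sq_le Q i x).completion

/-- The multiplier `Ξ_i`, with `Ξ_i (e_u) = q_{i u_1} ⋯ q_{i u_n} e_u`. -/
def multiplier (i : Fin N) : Fock Q →L[ℂ] Fock Q :=
  ((preMultiplier Q i).mkContinuous 1 fun x => by
    simpa using norm_preMultiplier_le Q i x).completion

theorem inner_tensor (u v : Word N) : inner ℂ (tensor Q u) (tensor Q v) = (gram Q u v : ℂ) := by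
  simp [tensor, UniformSpace.Completion.inner_coe]

theorem creation_tensor (i : Fin N) {n : ℕ} (u : Fin n → Fin N) :
    creation Q i (tensor Q ⟨n, u⟩) = tensor Q ⟨n + 1, Fin.cons i u⟩ := by
  simp only [creation, tensor]
  rw [ContinuousLinearMap.completion_apply_coe]
  simp [preCreation]

theorem multiplier_tensor (i : Fin N) (u : Word N) :
    multiplier Q i (tensor Q u) = ((∏ k, Q.coeff i (u.2 k) : ℝ) : ℂ) • tensor Q u := by
  simp only [multiplier, tensor]
  rw [ContinuousLinearMap.completion_apply_coe]
  simp [preMultiplier, letterWeight]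

/-- The left annihilation operator `l_i^*`; its action on elementary tensors is given by
`annihilation_tensor_zero` and `annihilation_tensor_succ`. -/
def annihilation (i : Fin N) : Fock Q →L[ℂ] Fock Q := ContinuousLinearMap.adjoint (creation Q i)

theorem annihilation_coe (i : Fin N) (x : PreFock Q) :
    annihilation Q i (x : Fock Q) = (preAnnihilation Q i x : PreFock Q) := by
  refine ext_inner_left ℂ fun z => ?_
  rw [annihilation, ContinuousLinearMap.adjoint_inner_right]
  induction z using UniformSpace.Completion.induction_on with
  | hp => exact isClosed_eq (by fun_prop) (by fun_prop)
  | ih z =>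
    rw [creation, ContinuousLinearMap.completion_apply_coe, UniformSpace.Completion.inner_coe,
      UniformSpace.Completion.inner_coe]
    exact inner_preCreation_left Q i z x

theorem annihilation_tensor_zero (i : Fin N) (v : Fin 0 → Fin N) :
    annihilation Q i (tensor Q ⟨0, v⟩) = 0 := by
  rw [tensor, annihilation_coe]
  simp only [preAnnihilation, PreFock.lift_basis, annihilateWord]
  exact UniformSpace.Completion.coe_zero

theorem annihilation_tensor_succ (i : Fin N) {n : ℕ} (v : Fin (n + 1) → Fin N) :
    annihilation Q i (tensor Q ⟨n + 1, v⟩) =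
      ∑ k, ((if v k = i then ∏ a, (if a < k then Q.coeff i (v a) else 1) else 0 : ℝ) : ℂ) •
        tensor Q ⟨n, k.removeNth v⟩ := by
  simp only [tensor]
  rw [annihilation_coe]
  simp only [preAnnihilation, PreFock.lift_basis, annihilateWord]
  rw [← UniformSpace.Completion.coe_toComplL (𝕜 := ℂ), map_sum]
  simp only [map_smul]

/-- The mixed `q`-Gaussian variable `X_i = l_i + l_i^*`. -/
def gaussian (i : Fin N) : Fock Q →L[ℂ] Fock Q := creation Q i + annihilation Q i

/-- `q = max |q_ij|`. -/
def DeformationMatrix.maxAbs {N : ℕ} (Q : DeformationMatrix N) : ℝ :=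
  ⨆ p : Fin N × Fin N, |Q.coeff p.1 p.2|

/-- The monomial `X_u = X_{u_1} ⋯ X_{u_n}`, equal to `1` for the empty word. -/
def gaussianMonomial (u : Word N) : Fock Q →L[ℂ] Fock Q :=
  (List.ofFn fun k => gaussian Q (u.2 k)).prod

/-- A formal noncommutative power series `∑ F(u, v) Y_u ⊗ Y_v` in the variables `Y_1, ..., Y_N`,
with complex coefficients and with values in the tensor square. -/
abbrev BiSeries (N : ℕ) : Type := Word N × Word N → ℂ

/-- The series `1 ⊗ 1°`. -/
def BiSeries.unit (N : ℕ) : BiSeries N := Pi.single (⟨0, Fin.elim0⟩, ⟨0, Fin.elim0⟩) 1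

/-- `‖F‖_R = ∑ |F(u, v)| R ^ (|u| + |v|)`, as an extended number. -/
def BiSeries.rNorm (F : BiSeries N) (R : ℝ) : ℝ≥0∞ :=
  ∑' p, ‖F p‖ₑ * ENNReal.ofReal R ^ (p.1.1 + p.2.1)

/-- The radius of convergence: the supremum of all `r` with `‖F‖_r < ∞`. -/
def BiSeries.radius (F : BiSeries N) : ℝ≥0∞ :=
  ⨆ (r : ℝ) (_ : F.rNorm r < ⊤), ENNReal.ofReal r

/-- The Hilbert-Schmidt norm: `‖T‖_HS ^ 2` is the supremum of `∑ ‖T x‖ ^ 2` over finite orthonormal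
families. It is infinite if `T` is not a Hilbert-Schmidt operator. -/
def hsNorm {H : Type*} [NormedAddCommGroup H] [InnerProductSpace ℂ H] (T : H →L[ℂ] H) : ℝ≥0∞ :=
  (⨆ (s : Finset H) (_ : Orthonormal ℂ (fun x : s => (x : H))), ∑ x ∈ s, ‖T x‖ₑ ^ 2) ^ (1 / 2 : ℝ)

/-- The Hilbert-Schmidt operator `ξ ↦ ⟨ξ, b^* Ω⟩ a Ω` that is identified with `a ⊗ b°`, where the
inner product in the formula is linear in `ξ`. -/
def tensorOp (a b : Fock Q →L[ℂ] Fock Q) : Fock Q →L[ℂ] Fock Q :=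
  InnerProductSpace.rankOne ℂ (a (vacuum Q)) (ContinuousLinearMap.adjoint b (vacuum Q))

/-- `F` is a power series representation of `T`: the series `∑ F(u, v) X_u ⊗ X_v°` converges to `T`
(unconditionally) in the Hilbert-Schmidt norm. -/
def BiSeries.Represents {Q : DeformationMatrix N} (F : BiSeries N) (T : Fock Q →L[ℂ] Fock Q) : Prop :=
  Tendsto (fun s : Finset (Word N × Word N) => hsNorm (T -
    ∑ p ∈ s, F p • tensorOp Q (gaussianMonomial Q p.1) (gaussianMonomial Q p.2))) atTop (𝓝 0)

end MixedQGaussian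

end

noncomputable section

namespace MixedQGaussian

open scoped ENNReal Topology
open Filter

variable {N : ℕ} (Q : DeformationMatrix N)

/-! `Ξ_i` is diagonal on elementary tensors, so if vectors `f_u` satisfy `⟨f_u, e_v⟩ = δ_{uv}`, then
formally `Ξ_i` is the sum over words `u` of `q_i(u)` times the rank one operator `ξ ↦ ⟨f_u, ξ⟩ e_u`.
The proof writes `e_u` and `f_u` as polynomials in the `X_j` applied to `Ω` and shows that the
coefficients stay summable.

Put `s = r + 1/(1-q)`. The relation `e_i ⊗ e_w = X_i e_w - l_i^* e_w` yields polynomials `ψ_u` with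
`ψ_u Ω = e_u` and weighted `ℓ¹`-norm at most `s^n` for `|u| = n` (`linearCombination_wick`,
`seriesNorm_wick_le`). The recursion for the Gram matrix writes it, one letter at a time, as an
`ℓ¹`-perturbation of the identity of size at most `q/(1-q)`. Hence the rows of its inverse have
`ℓ¹`-norm at most `K^n`, with `K = (1-q)/(1-2q)` (`sum_abs_gram_ge`, `exists_gram_inverse`), and the
dual polynomials `φ_u` have norm at most `(K s)^n` (`exists_dual_wick`).

The term of `u` therefore has norm at most `(q K s^2)^n`. There are `N^n` words of length `n`, so
everything is dominated by a geometric series of ratio `t = N q K s^2`. At `r = R` one has `s =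
(3+ε)/(1-q)`, and the hypothesis forces `t < 1`. The empty word contributes `1 ⊗ 1°`, which leaves
`t/(1-t)` as the error, and continuity of `t` in `r` gives a radius beyond `R`. Since `‖X_j‖ < R`,
the norm `‖F‖_R` dominates the sum of the Hilbert–Schmidt norms of the terms of `F`, so coefficient
convergence implies convergence of operators. -/

/-! ### The Gram matrix and its inverse in `ℓ¹` -/

theorem sum_cons {M : Type*} [AddCommMonoid M] {n : ℕ} (f : (Fin (n + 1) → Fin N) → M) :
    ∑ u, f u = ∑ i, ∑ w : Fin n → Fin N, f (Fin.cons i w) := by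
  rw [← (Fin.consEquiv (fun _ : Fin (n + 1) => Fin N)).sum_comp, Fintype.sum_prod_type]
  rfl

theorem geom_sum_fin_le {q : ℝ} (h0 : 0 ≤ q) (h1 : q < 1) (n : ℕ) :
    ∑ k : Fin n, q ^ (k : ℕ) ≤ (1 - q)⁻¹ := by
  rw [Fin.sum_univ_eq_sum_range (fun k => q ^ k), ← tsum_geometric_of_lt_one h0 h1]
  exact (summable_geometric_of_lt_one h0 h1).sum_le_tsum _ fun k _ => pow_nonneg h0 k

variable {Q} in
theorem abs_prod_lt_le {q : ℝ} (hq : ∀ i j, |Q.coeff i j| ≤ q) (i : Fin N) {n : ℕ}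
    (v : Fin n → Fin N) (k : Fin n) :
    |∏ a, if a < k then Q.coeff i (v a) else 1| ≤ q ^ (k : ℕ) := by
  rw [Finset.abs_prod]
  calc ∏ a, |if a < k then Q.coeff i (v a) else 1| ≤ ∏ a, if a < k then q else 1 := by
        refine Finset.prod_le_prod (fun _ _ => abs_nonneg _) fun a _ => ?_
        split_ifs
        · exact hq _ _
        · simp
    _ = q ^ (k : ℕ) := by
        rw [Finset.prod_ite, Finset.prod_const_one, mul_one, Finset.prod_const]
        congr 1
        rw [show Finset.univ.filter (· < k) = Finset.Iio k by ext; simp, Fin.card_Iio]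

variable {Q} in
/-- The Gram matrix of the tensors of length `n` expands the `ℓ¹`-norm by at least the `n`-th power
of `1 - ∑_{k ≥ 1} q ^ k`. -/
theorem sum_abs_gram_ge {q : ℝ} (hq : ∀ i j, |Q.coeff i j| ≤ q) (h0 : 0 ≤ q) (h1 : q < 1 / 2)
    (n : ℕ) (x : (Fin n → Fin N) → ℝ) :
    (1 - q * (1 - q)⁻¹) ^ n * ∑ v, |x v| ≤ ∑ u, |∑ v, gram Q ⟨n, u⟩ ⟨n, v⟩ * x v| := by
  have hc : 0 ≤ 1 - q * (1 - q)⁻¹ := by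
    rw [sub_nonneg, ← div_eq_mul_inv, div_le_one (by linarith)]; linarith
  induction n with
  | zero => simp [gram, crossing, Finset.univ_unique, Subsingleton.elim _ (default : Fin 0 → Fin N)]
  | succ n ih =>
    let C (i : Fin N) (v : Fin (n + 1) → Fin N) (k : Fin (n + 1)) : ℝ :=
      ∏ a, if a < k then Q.coeff i (v a) else 1
    -- In `gram_cons_succ` the leading letter `i` is paired with a letter of `v`. Position `0` has
    -- coefficient one and gives back `x`; `z` collects the later positions.
    let z (i : Fin N) (w : Fin n → Fin N) : ℝ := ∑ v : Fin (n + 1) → Fin N, ∑ k : Fin n,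
      if v k.succ = i ∧ k.succ.removeNth v = w then C i v k.succ * x v else 0
    have hgram : ∀ i u, ∑ v, gram Q ⟨n + 1, Fin.cons i u⟩ ⟨n + 1, v⟩ * x v =
        ∑ w, gram Q ⟨n, u⟩ ⟨n, w⟩ * (x (Fin.cons i w) + z i w) := by
      intro i u
      simp only [gram_cons_succ, Fin.sum_univ_succ (n := n), add_mul, mul_add,
        Finset.sum_add_distrib]
      congr 1
      · rw [sum_cons, Finset.sum_eq_single i]
        · simp [Fin.removeNth_zero]
        · intro j _ hj; simp [hj]
        · simp
      · simp only [z, Finset.mul_sum, Finset.sum_mul]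
        symm
        rw [Finset.sum_comm]
        refine Finset.sum_congr rfl fun v _ => ?_
        rw [Finset.sum_comm]
        refine Finset.sum_congr rfl fun k _ => ?_
        by_cases h : v k.succ = i
        · simp [h, C]; ring
        · simp [h]
    have hz : ∑ i, ∑ w, |z i w| ≤ q * (1 - q)⁻¹ * ∑ v, |x v| := by
      calc ∑ i, ∑ w, |z i w|
          ≤ ∑ i, ∑ w, ∑ v : Fin (n + 1) → Fin N, ∑ k : Fin n,
            (if v k.succ = i ∧ k.succ.removeNth v = w then q ^ (k : ℕ) * q * |x v| else 0) := by
            refine Finset.sum_le_sum fun i _ => Finset.sum_le_sum fun w _ => ?_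
            refine (Finset.abs_sum_le_sum_abs _ _).trans (Finset.sum_le_sum fun v _ => ?_)
            refine (Finset.abs_sum_le_sum_abs _ _).trans (Finset.sum_le_sum fun k _ => ?_)
            split_ifs
            · rw [abs_mul]
              gcongr
              simpa [pow_succ] using abs_prod_lt_le hq i v k.succ
            · simp
        -- A pair `(v, k)` determines the removed letter `i` and the remaining word `w`, so it is
        -- counted exactly once.
        _ = ∑ v : Fin (n + 1) → Fin N, ∑ k : Fin n, q ^ (k : ℕ) * q * |x v| := by
            simp_rw [Finset.sum_comm (s := (Finset.univ : Finset (Fin n → Fin N)))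
              (t := (Finset.univ : Finset (Fin (n + 1) → Fin N)))]
            rw [Finset.sum_comm]
            refine Finset.sum_congr rfl fun v _ => ?_
            simp_rw [Finset.sum_comm (s := (Finset.univ : Finset (Fin n → Fin N)))
              (t := (Finset.univ : Finset (Fin n)))]
            rw [Finset.sum_comm]
            refine Finset.sum_congr rfl fun k _ => ?_
            simp [ite_and]
        _ = (∑ k : Fin n, q ^ (k : ℕ)) * q * ∑ v, |x v| := by
            simp_rw [← Finset.sum_mul, ← Finset.mul_sum]
        _ ≤ (1 - q)⁻¹ * q * ∑ v, |x v| := by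
            gcongr
            exact geom_sum_fin_le h0 (by linarith) n
        _ = _ := by ring
    -- Reverse triangle inequality: identity plus a perturbation of `ℓ¹`-norm at most `q/(1-q) < 1`.
    have hy : (1 - q * (1 - q)⁻¹) * ∑ v, |x v| ≤ ∑ i, ∑ w, |x (Fin.cons i w) + z i w| := by
      have h2 : ∑ v, |x v| ≤ (∑ i, ∑ w, |x (Fin.cons i w) + z i w|) + ∑ i, ∑ w, |z i w| := by
        rw [sum_cons]
        simp only [← Finset.sum_add_distrib]
        refine Finset.sum_le_sum fun i _ => Finset.sum_le_sum fun w _ => ?_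
        have := abs_sub (x (Fin.cons i w) + z i w) (z i w)
        simpa using this
      linarith
    calc (1 - q * (1 - q)⁻¹) ^ (n + 1) * ∑ v, |x v|
        = (1 - q * (1 - q)⁻¹) ^ n * ((1 - q * (1 - q)⁻¹) * ∑ v, |x v|) := by ring
      _ ≤ (1 - q * (1 - q)⁻¹) ^ n * ∑ i, ∑ w, |x (Fin.cons i w) + z i w| := by gcongr
      _ = ∑ i, (1 - q * (1 - q)⁻¹) ^ n * ∑ w, |x (Fin.cons i w) + z i w| := by
          rw [Finset.mul_sum]
      _ ≤ ∑ i, ∑ u, |∑ w, gram Q ⟨n, u⟩ ⟨n, w⟩ * (x (Fin.cons i w) + z i w)| :=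
          Finset.sum_le_sum fun i _ => ih _
      _ = _ := by rw [sum_cons]; simp only [hgram]

variable {Q} in
/-- The inverse of the Gram matrix of the tensors of length `n`, with an `ℓ¹`-bound. -/
theorem exists_gram_inverse {q : ℝ} (hq : ∀ i j, |Q.coeff i j| ≤ q) (h0 : 0 ≤ q) (h1 : q < 1 / 2)
    (n : ℕ) : ∃ M : (Fin n → Fin N) → (Fin n → Fin N) → ℝ,
      (∀ u v, ∑ w, M u w * gram Q ⟨n, w⟩ ⟨n, v⟩ = if u = v then 1 else 0) ∧
      ∀ u, ∑ v, |M u v| ≤ (1 - q * (1 - q)⁻¹)⁻¹ ^ n := by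
  have hc : 0 < 1 - q * (1 - q)⁻¹ := by
    rw [sub_pos, ← div_eq_mul_inv, div_lt_one (by linarith)]; linarith
  let G : Matrix (Fin n → Fin N) (Fin n → Fin N) ℝ := fun u v => gram Q ⟨n, u⟩ ⟨n, v⟩
  have hG : ∀ x, (1 - q * (1 - q)⁻¹) ^ n * ∑ v, |x v| ≤ ∑ u, |G.mulVec x u| :=
    sum_abs_gram_ge hq h0 h1 n
  have hinj : Function.Injective G.mulVecLin := by
    rw [← LinearMap.ker_eq_bot, LinearMap.ker_eq_bot']
    intro x hx
    have h2 := hG x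
    rw [← Matrix.mulVecLin_apply, hx] at h2
    simp only [Pi.zero_apply, abs_zero, Finset.sum_const_zero] at h2
    have h3 : ∑ v, |x v| = 0 :=
      le_antisymm (by by_contra! h; exact absurd h2 (not_le.2 (by positivity)))
        (Finset.sum_nonneg fun _ _ => abs_nonneg _)
    ext v
    simpa using (Finset.sum_eq_zero_iff_of_nonneg fun _ _ => abs_nonneg _).1 h3 v (Finset.mem_univ v)
  -- In finite dimension the expansion estimate, which gives injectivity, also gives invertibility.
  -- Applied to the preimages of the unit vectors, it bounds the inverse.
  have hsurj := LinearMap.surjective_of_injective hinj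
  choose M hM using fun u => hsurj (Pi.single u 1)
  refine ⟨M, fun u v => ?_, fun u => ?_⟩
  · have := congrFun (hM u) v
    rw [Matrix.mulVecLin_apply, Matrix.mulVec, dotProduct, Pi.single_apply] at this
    simp only [eq_comm (a := u), ← this, G]
    exact Finset.sum_congr rfl fun w _ => by rw [mul_comm, gram_symm]
  · have h2 := hG (M u)
    rw [← Matrix.mulVecLin_apply, hM] at h2
    rw [inv_pow, ← one_div, le_div_iff₀' (by positivity)]
    refine h2.trans (le_of_eq ?_)
    simp [Pi.single_apply, apply_ite abs]

/-! ### Hilbert–Schmidt norms of sums of rank one operators -/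

section HilbertSchmidt

variable {H : Type*} [NormedAddCommGroup H] [InnerProductSpace ℂ H]

/-- For a fixed finite orthonormal family, the quantity in the supremum is the square of an honest
norm, that of `(T x)_x` in an `ℓ²`-sum. This makes the triangle inequality for infinite sums
available family by family. -/
theorem hsNorm_le {T : H →L[ℂ] H} {c : ℝ≥0∞}
    (h : ∀ s : Finset H, Orthonormal ℂ (fun x : s => (x : H)) →
      ‖WithLp.toLp 2 (fun x : s => T x)‖ₑ ≤ c) : hsNorm T ≤ c := by
  have hc : (c ^ 2) ^ (1 / 2 : ℝ) = c := by
    rw [← ENNReal.rpow_natCast, ← ENNReal.rpow_mul]; simp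
  rw [hsNorm, ← hc]
  refine ENNReal.rpow_le_rpow (iSup₂_le fun s hs => ?_) (by norm_num)
  refine le_trans (le_of_eq ?_) (pow_le_pow_left' (h s hs) 2)
  simp only [← ofReal_norm]
  rw [← ENNReal.ofReal_pow (norm_nonneg _), PiLp.norm_sq_eq_of_L2,
    ENNReal.ofReal_sum_of_nonneg fun _ _ => sq_nonneg _, ← Finset.sum_coe_sort]
  exact Finset.sum_congr rfl fun x _ => (ENNReal.ofReal_pow (norm_nonneg _) 2).symm

theorem enorm_toLp_rankOne_le {s : Finset H} (hs : Orthonormal ℂ (fun x : s => (x : H))) (a b : H) :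
    ‖WithLp.toLp 2 (fun x : s => InnerProductSpace.rankOne ℂ a b x)‖ₑ ≤ ‖a‖ₑ * ‖b‖ₑ := by
  rw [← enorm_norm a, ← enorm_norm b, ← enorm_mul]
  refine enorm_le_iff_norm_le.2 ?_
  rw [Real.norm_of_nonneg (by positivity)]
  refine le_of_sq_le_sq ?_ (by positivity)
  rw [PiLp.norm_sq_eq_of_L2]
  -- Bessel's inequality bounds the sum of the `|⟨b, x⟩|^2` by `‖b‖^2`.
  have h := hs.sum_inner_products_le (x := b) (s := Finset.univ)
  simp only [InnerProductSpace.rankOne_apply, norm_smul, mul_pow, ← Finset.sum_mul]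
  rw [mul_comm]
  gcongr
  simpa only [norm_inner_symm b] using h

/-- The Hilbert-Schmidt norm is countably subadditive on sums of rank one operators. -/
theorem hsNorm_le_tsum {ι : Type*} {a b : ι → H} {T : H →L[ℂ] H}
    (h : HasSum (fun p => InnerProductSpace.rankOne ℂ (a p) (b p)) T) :
    hsNorm T ≤ ∑' p, ‖a p‖ₑ * ‖b p‖ₑ := by
  refine hsNorm_le fun s hs => ?_
  have h1 : HasSum (fun p => WithLp.toLp 2 fun x : s => InnerProductSpace.rankOne ℂ (a p) (b p) x)
      (WithLp.toLp 2 fun x : s => T x) := by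
    refine HasSum.mapL (PiLp.continuousLinearEquiv 2 ℂ (fun _ : s => H)).symm.toContinuousLinearMap
      (Pi.hasSum.2 fun x => ?_)
    exact h.mapL (ContinuousLinearMap.apply ℂ H (x : H))
  rw [← h1.tsum_eq]
  exact enorm_tsum_le_tsum_enorm.trans
    (ENNReal.tsum_le_tsum fun p => enorm_toLp_rankOne_le hs (a p) (b p))

/-- The error after a finite partial sum is itself the sum over the complementary indices, so its
Hilbert–Schmidt norm is at most the tail of a convergent series. -/
theorem tendsto_hsNorm_sub_sum {ι : Type*} {a b : ι → H} {T : H →L[ℂ] H}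
    (h : HasSum (fun p => InnerProductSpace.rankOne ℂ (a p) (b p)) T)
    (hab : ∑' p, ‖a p‖ₑ * ‖b p‖ₑ ≠ ⊤) :
    Tendsto (fun s : Finset ι => hsNorm (T - ∑ p ∈ s, InnerProductSpace.rankOne ℂ (a p) (b p)))
      atTop (𝓝 0) := by
  refine tendsto_of_tendsto_of_tendsto_of_le_of_le tendsto_const_nhds
    (ENNReal.tendsto_tsum_compl_atTop_zero hab) (fun _ => zero_le) fun s => ?_
  refine hsNorm_le_tsum (a := fun p : {p // p ∉ s} => a p) (b := fun p => b p) ?_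
  rw [← sub_add_cancel T (∑ p ∈ s, InnerProductSpace.rankOne ℂ (a p) (b p))] at h
  exact (Finset.hasSum_compl_iff s).2 h

end HilbertSchmidt

/-! ### Weighted `ℓ¹`-norms, Wick polynomials and their duals -/

/-- Prefixing a word with a letter. -/
def Word.cons (i : Fin N) (w : Word N) : Word N := ⟨w.1 + 1, Fin.cons i w.2⟩

theorem Word.cons_injective (i : Fin N) : Function.Injective (Word.cons i) := by
  rintro ⟨m, u⟩ ⟨n, v⟩ h
  obtain rfl : m = n := by simpa [Word.cons] using congrArg Sigma.fst h
  have := eq_of_heq (Sigma.mk.inj_iff.1 h).2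
  simpa using this

/-- The weighted `ℓ¹`-norm `∑ |ψ(w)| r ^ |w|` of a power series with coefficients `ψ`. -/
def seriesNorm (r : ℝ≥0∞) (ψ : Word N → ℂ) : ℝ≥0∞ := ∑' w, ‖ψ w‖ₑ * r ^ w.1

theorem seriesNorm_add_le (r : ℝ≥0∞) (ψ φ : Word N → ℂ) :
    seriesNorm r (ψ + φ) ≤ seriesNorm r ψ + seriesNorm r φ := by
  unfold seriesNorm
  rw [← ENNReal.tsum_add]
  refine ENNReal.tsum_le_tsum fun w => ?_
  rw [← add_mul]
  gcongr
  exact enorm_add_le _ _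

theorem seriesNorm_sub_le (r : ℝ≥0∞) (ψ φ : Word N → ℂ) :
    seriesNorm r (ψ - φ) ≤ seriesNorm r ψ + seriesNorm r φ := by
  unfold seriesNorm
  rw [← ENNReal.tsum_add]
  refine ENNReal.tsum_le_tsum fun w => ?_
  rw [← add_mul]
  gcongr
  exact enorm_sub_le

theorem seriesNorm_smul (r : ℝ≥0∞) (c : ℂ) (ψ : Word N → ℂ) :
    seriesNorm r (c • ψ) = ‖c‖ₑ * seriesNorm r ψ := by
  simp only [seriesNorm, Pi.smul_apply, smul_eq_mul, enorm_mul, mul_assoc, ENNReal.tsum_mul_left]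

theorem seriesNorm_sum_le {ι : Type*} (s : Finset ι) (r : ℝ≥0∞) (ψ : ι → Word N → ℂ) :
    seriesNorm r (∑ k ∈ s, ψ k) ≤ ∑ k ∈ s, seriesNorm r (ψ k) := by
  classical
  induction s using Finset.induction_on with
  | empty => simp [seriesNorm]
  | insert k s hk ih =>
    rw [Finset.sum_insert hk, Finset.sum_insert hk]
    exact (seriesNorm_add_le _ _ _).trans (by gcongr)

theorem seriesNorm_single (r : ℝ≥0∞) (w : Word N) :
    seriesNorm r (Finsupp.single w (1 : ℂ)) = r ^ w.1 := by
  unfold seriesNorm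
  rw [tsum_eq_single w]
  · simp
  · intro v hv; simp [hv]

theorem seriesNorm_mapDomain_cons (r : ℝ≥0∞) (i : Fin N) (ψ : Word N →₀ ℂ) :
    seriesNorm r (ψ.mapDomain (Word.cons i)) = r * seriesNorm r ψ := by
  unfold seriesNorm
  rw [← (Word.cons_injective i).tsum_eq, ← ENNReal.tsum_mul_left]
  · refine tsum_congr fun w => ?_
    rw [Finsupp.mapDomain_apply (Word.cons_injective i)]
    simp only [Word.cons, pow_succ]
    ring
  · intro w hw
    by_contra h
    exact hw (by simp [Finsupp.mapDomain_of_notMem_range ψ w h])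

/-- The coefficients of the polynomial `ψ` in the variables `X_1, ..., X_N` with `ψ Ω = e_v`. -/
def wick : (n : ℕ) → (Fin n → Fin N) → (Word N →₀ ℂ)
  | 0, v => Finsupp.single ⟨0, v⟩ 1
  | 1, v => Finsupp.single ⟨1, v⟩ 1
  | n + 2, v => (wick (n + 1) (Fin.tail v)).mapDomain (Word.cons (v 0)) - ∑ k : Fin (n + 1),
      ((if Fin.tail v k = v 0 then
        ∏ a, (if a < k then Q.coeff (v 0) (Fin.tail v a) else 1) else 0 : ℝ) : ℂ) •
        wick n (k.removeNth (Fin.tail v))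

-- Prefixing a letter costs a factor `r`, and the annihilation part costs at most `1 + q + q^2 + ⋯ ≤
-- 1/(1-q)` while shortening the word by two. Two-step induction absorbs both costs into `r +
-- 1/(1-q)`.
variable {Q} in
theorem seriesNorm_wick_le {q r : ℝ} (hq : ∀ i j, |Q.coeff i j| ≤ q) (h0 : 0 ≤ q) (h1 : q < 1)
    (hr : 0 ≤ r) : ∀ (n : ℕ) (v : Fin n → Fin N),
    seriesNorm (ENNReal.ofReal r) (wick Q n v) ≤ ENNReal.ofReal (r + (1 - q)⁻¹) ^ n
  | 0, v => by simp [wick, seriesNorm_single]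
  | 1, v => by
      have : 0 ≤ (1 - q)⁻¹ := inv_nonneg.2 (by linarith)
      rw [wick, seriesNorm_single]
      exact pow_le_pow_left' (ENNReal.ofReal_le_ofReal (by linarith)) _
  | n + 2, v => by
      have hs : 1 ≤ (1 - q)⁻¹ := (one_le_inv₀ (by linarith)).2 (by linarith)
      set s := (1 - q)⁻¹ with hs_def
      have hsum : seriesNorm (ENNReal.ofReal r) (∑ k : Fin (n + 1),
          ((if Fin.tail v k = v 0 then
            ∏ a, (if a < k then Q.coeff (v 0) (Fin.tail v a) else 1) else 0 : ℝ) : ℂ) •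
            ⇑(wick Q n (k.removeNth (Fin.tail v)))) ≤
          ENNReal.ofReal s * ENNReal.ofReal (r + s) ^ n := by
        refine (seriesNorm_sum_le _ _ _).trans ?_
        calc _ ≤ ∑ k : Fin (n + 1), ENNReal.ofReal (q ^ (k : ℕ)) * ENNReal.ofReal (r + s) ^ n := by
              refine Finset.sum_le_sum fun k _ => ?_
              rw [seriesNorm_smul]
              refine mul_le_mul' ?_ (seriesNorm_wick_le hq h0 h1 hr n _)
              rw [← ofReal_norm, Complex.norm_real, Real.norm_eq_abs]
              refine ENNReal.ofReal_le_ofReal ?_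
              split_ifs
              · exact abs_prod_lt_le hq _ _ _
              · simpa using pow_nonneg h0 _
          _ ≤ _ := by
              rw [← Finset.sum_mul, ← ENNReal.ofReal_sum_of_nonneg fun k _ => pow_nonneg h0 _]
              gcongr
              exact geom_sum_fin_le h0 h1 _
      have hcoe : (wick Q (n + 2) v : Word N → ℂ) =
          ⇑((wick Q (n + 1) (Fin.tail v)).mapDomain (Word.cons (v 0))) - ∑ k : Fin (n + 1),
          ((if Fin.tail v k = v 0 then
            ∏ a, (if a < k then Q.coeff (v 0) (Fin.tail v a) else 1) else 0 : ℝ) : ℂ) •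
            ⇑(wick Q n (k.removeNth (Fin.tail v))) := by
        simp only [wick, Finsupp.coe_sub, Finsupp.coe_finsetSum, Finsupp.coe_smul]
      rw [hcoe]
      calc _ ≤ ENNReal.ofReal r * ENNReal.ofReal (r + s) ^ (n + 1) +
            ENNReal.ofReal s * ENNReal.ofReal (r + s) ^ n := by
            refine (seriesNorm_sub_le _ _ _).trans (add_le_add ?_ hsum)
            rw [seriesNorm_mapDomain_cons]
            gcongr
            exact seriesNorm_wick_le hq h0 h1 hr (n + 1) _
        -- The inequality needed is `r(r+s) + s ≤ (r+s)^2`, which holds because `s ≥ 1`.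
        _ ≤ ENNReal.ofReal ((r + s) * (r + s)) * ENNReal.ofReal (r + s) ^ n := by
            rw [pow_succ', ← mul_assoc, ← add_mul, ← ENNReal.ofReal_mul hr,
              ← ENNReal.ofReal_add (by positivity) (by positivity)]
            gcongr
            nlinarith
        _ = _ := by
            rw [ENNReal.ofReal_mul (by positivity)]; ring

theorem gaussianMonomial_cons (i : Fin N) (w : Word N) :
    gaussianMonomial Q (Word.cons i w) = gaussian Q i * gaussianMonomial Q w := by
  simp [gaussianMonomial, Word.cons, List.ofFn_succ]

/-- The vector `X_w Ω`. -/
def momentVector (w : Word N) : Fock Q := gaussianMonomial Q w (vacuum Q)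

theorem linearCombination_wick : ∀ (n : ℕ) (v : Fin n → Fin N),
    Finsupp.linearCombination ℂ (momentVector Q) (wick Q n v) = tensor Q ⟨n, v⟩
  | 0, v => by
      simp [wick, momentVector, gaussianMonomial, vacuum, Subsingleton.elim v Fin.elim0]
  | 1, v => by
      rw [wick, Finsupp.linearCombination_single, one_smul, momentVector, gaussianMonomial]
      simp only [List.ofFn_succ, List.ofFn_zero, List.prod_cons, List.prod_nil, mul_one, gaussian,
        add_apply, vacuum, annihilation_tensor_zero, creation_tensor, add_zero]
      congr 2
      exact funext fun k => Fin.cases rfl (fun j => j.elim0) k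
  | n + 2, v => by
      have hmap : ∀ ψ : Word N →₀ ℂ,
          Finsupp.linearCombination ℂ (momentVector Q) (ψ.mapDomain (Word.cons (v 0))) =
            gaussian Q (v 0) (Finsupp.linearCombination ℂ (momentVector Q) ψ) := by
        intro ψ
        rw [Finsupp.linearCombination_mapDomain, ← ContinuousLinearMap.coe_coe,
          Finsupp.apply_linearCombination]
        congr 2
        ext w
        simp [momentVector, gaussianMonomial_cons]
      rw [wick, map_sub, hmap, linearCombination_wick (n + 1)]
      simp only [map_sum, map_smul, linearCombination_wick n]
      -- `X_i e_w = e_i ⊗ e_w + l_i^* e_w`, and the subtracted sum in `wick` is exactly `l_i^* e_w`.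
      rw [gaussian, add_apply, creation_tensor, annihilation_tensor_succ,
        add_sub_cancel_right, Fin.cons_self_tail]

variable {Q} in
/-- Polynomials in the variables `X_1, ..., X_N` whose vectors form the dual family of the elementary
tensors. -/
theorem exists_dual_wick {q : ℝ} (hq : ∀ i j, |Q.coeff i j| ≤ q) (h0 : 0 ≤ q) (h1 : q < 1 / 2) :
    ∃ φ : Word N → (Word N →₀ ℂ),
      (∀ u v, inner ℂ (Finsupp.linearCombination ℂ (momentVector Q) (φ u)) (tensor Q v) =
        if u = v then 1 else 0) ∧
      φ ⟨0, Fin.elim0⟩ = Finsupp.single ⟨0, Fin.elim0⟩ 1 ∧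
      ∀ r : ℝ, 0 ≤ r → ∀ u, seriesNorm (ENNReal.ofReal r) (φ u) ≤
        (ENNReal.ofReal (1 - q * (1 - q)⁻¹)⁻¹ * ENNReal.ofReal (r + (1 - q)⁻¹)) ^ u.1 := by
  choose M hM hMs using exists_gram_inverse hq h0 h1
  -- Inverting the Gram matrix within each length suffices, since tensors of different lengths are
  -- orthogonal.
  refine ⟨fun u => ∑ w, (M u.1 u.2 w : ℂ) • wick Q u.1 w, fun u v => ?_, ?_, fun r hr u => ?_⟩
  · obtain ⟨m, u⟩ := u
    obtain ⟨n, v⟩ := v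
    simp only [map_sum, map_smul, linearCombination_wick, sum_inner, inner_smul_left, inner_tensor,
      Complex.conj_ofReal]
    by_cases hmn : m = n
    · subst hmn
      have h := hM m u v
      have hiff : (⟨m, u⟩ : Word N) = ⟨m, v⟩ ↔ u = v := by simp
      simp only [hiff]
      have h' := congrArg (fun t : ℝ => (t : ℂ)) h
      push_cast at h'
      rw [h']
      split_ifs <;> simp
    · have hne : (⟨m, u⟩ : Word N) ≠ ⟨n, v⟩ := fun h => hmn (congrArg Sigma.fst h)
      rw [if_neg hne]
      exact Finset.sum_eq_zero fun w _ => by rw [gram_eq_zero _ _ _ hmn]; simp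
  · have h := hM 0 Fin.elim0 Fin.elim0
    simp only [Finset.univ_unique, Finset.sum_singleton, if_true] at h ⊢
    have hd : (default : Fin 0 → Fin N) = Fin.elim0 := Subsingleton.elim _ _
    have hg : gram Q ⟨0, Fin.elim0⟩ ⟨0, Fin.elim0⟩ = 1 := by simp [gram, crossing]
    rw [hd, hg, mul_one] at h
    rw [hd, h]
    simp [wick]
  · have hsum : seriesNorm (ENNReal.ofReal r) (∑ w, (M u.1 u.2 w : ℂ) • ⇑(wick Q u.1 w)) ≤
        (ENNReal.ofReal (1 - q * (1 - q)⁻¹)⁻¹ * ENNReal.ofReal (r + (1 - q)⁻¹)) ^ u.1 := by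
      refine (seriesNorm_sum_le _ _ _).trans ?_
      calc _ ≤ ∑ w, ENNReal.ofReal |M u.1 u.2 w| * ENNReal.ofReal (r + (1 - q)⁻¹) ^ u.1 := by
            refine Finset.sum_le_sum fun w _ => ?_
            rw [seriesNorm_smul]
            refine mul_le_mul' (le_of_eq ?_) (seriesNorm_wick_le hq h0 (by linarith) hr _ _)
            rw [← ofReal_norm, Complex.norm_real, Real.norm_eq_abs]
        _ ≤ _ := by
            have hc : 0 ≤ 1 - q * (1 - q)⁻¹ := by
              rw [sub_nonneg, ← div_eq_mul_inv, div_le_one (by linarith)]; linarith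
            rw [← Finset.sum_mul, ← ENNReal.ofReal_sum_of_nonneg fun _ _ => abs_nonneg _, mul_pow,
              ← ENNReal.ofReal_pow (inv_nonneg.2 hc)]
            gcongr
            exact hMs u.1 u.2
    simpa only [Finsupp.coe_finsetSum, Finsupp.coe_smul] using hsum

/-! ### Adjoints, norms and density in the Fock space -/

theorem adjoint_gaussian (i : Fin N) :
    ContinuousLinearMap.adjoint (gaussian Q i) = gaussian Q i := by
  rw [gaussian, annihilation, map_add, ContinuousLinearMap.adjoint_adjoint, add_comm]

/-- Reading a word backwards. -/
def Word.reverse : Word N ≃ Word N where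
  toFun w := ⟨w.1, fun k => w.2 k.rev⟩
  invFun w := ⟨w.1, fun k => w.2 k.rev⟩
  left_inv w := by simp
  right_inv w := by simp

/-- The source of the word reversals below: `a ⊗ b°` involves `b^* Ω`, and the variables are
self-adjoint. -/
theorem adjoint_gaussianMonomial (w : Word N) :
    ContinuousLinearMap.adjoint (gaussianMonomial Q w) = gaussianMonomial Q (Word.reverse w) := by
  have hl : ∀ l : List (Fin N), ContinuousLinearMap.adjoint ((l.map (gaussian Q)).prod) =
      (l.reverse.map (gaussian Q)).prod := by
    intro l
    induction l with
    | nil => exact ContinuousLinearMap.adjoint_id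
    | cons i l ih =>
      rw [List.map_cons, List.prod_cons, ContinuousLinearMap.mul_def,
        ContinuousLinearMap.adjoint_comp, ih, adjoint_gaussian]
      simp [ContinuousLinearMap.mul_def]
  have hm : ∀ w : Word N, gaussianMonomial Q w = ((List.ofFn w.2).map (gaussian Q)).prod := by
    intro w
    rw [List.map_ofFn]; rfl
  rw [hm, hm, hl]
  congr 2
  refine List.ext_getElem (by simp [Word.reverse]) fun k h h' => ?_
  rw [List.getElem_reverse, List.getElem_ofFn, List.getElem_ofFn]
  refine congrArg w.2 (Fin.ext ?_)
  change (List.ofFn w.2).length - 1 - k = w.1 - (k + 1)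
  rw [List.length_ofFn]
  omega

theorem norm_creation_le (i : Fin N) : ‖creation Q i‖ ≤ Real.sqrt (1 - |Q.coeff i i|)⁻¹ := by
  refine ContinuousLinearMap.opNorm_le_bound _ (Real.sqrt_nonneg _) fun x => ?_
  induction x using UniformSpace.Completion.induction_on with
  | hp => exact isClosed_le (by fun_prop) (by fun_prop)
  | ih x =>
    rw [creation, ContinuousLinearMap.completion_apply_coe, UniformSpace.Completion.norm_coe,
      UniformSpace.Completion.norm_coe]
    refine le_of_sq_le_sq ?_ (by positivity)
    rw [mul_pow, Real.sq_sqrt (inv_nonneg.2 (by linarith [Q.abs_lt_one i i]))]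
    exact norm_preCreation_sq_le Q i x

variable {Q} in
theorem norm_gaussian_le {q : ℝ} (hq : ∀ i j, |Q.coeff i j| ≤ q) (h1 : q < 1) (i : Fin N) :
    ‖gaussian Q i‖ ≤ 2 * (1 - q)⁻¹ := by
  have hc : ‖creation Q i‖ ≤ (1 - q)⁻¹ := by
    -- The square root is dropped using `√x ≤ x` for `x ≥ 1`; the resulting bound `2/(1-q)` is still
    -- below `R`.
    refine (norm_creation_le Q i).trans ((Real.sqrt_le_sqrt (y := (1 - q)⁻¹) ?_).trans
      (Real.sqrt_le_self_iff.2 (Or.inr ?_)))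
    · exact inv_anti₀ (by linarith) (by linarith [hq i i])
    · exact (one_le_inv₀ (by linarith)).2 (by linarith [hq i i, abs_nonneg (Q.coeff i i)])
  calc ‖gaussian Q i‖ ≤ ‖creation Q i‖ + ‖annihilation Q i‖ := norm_add_le _ _
    _ = ‖creation Q i‖ + ‖creation Q i‖ := by
        rw [annihilation, LinearIsometryEquiv.norm_map]
    _ ≤ _ := by linarith

theorem norm_vacuum : ‖vacuum Q‖ = 1 := by
  have h : inner ℂ (vacuum Q) (vacuum Q) = 1 := by
    rw [vacuum, inner_tensor]; simp [gram, crossing]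
  rw [inner_self_eq_norm_sq_to_K] at h
  have h' : ‖vacuum Q‖ ^ 2 = 1 := Complex.ofReal_injective (by simpa using h)
  exact (pow_eq_one_iff_of_nonneg (norm_nonneg _) two_ne_zero).1 h'

variable {Q} in
theorem enorm_momentVector_le {R : ℝ} (hR : ∀ i, ‖gaussian Q i‖ ≤ R) :
    ∀ w : Word N, ‖momentVector Q w‖ₑ ≤ ENNReal.ofReal R ^ w.1 := by
  rintro ⟨n, w⟩
  induction n with
  | zero => simp [momentVector, gaussianMonomial, ← ofReal_norm, norm_vacuum]
  | succ n ih =>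
    have h : momentVector Q ⟨n + 1, w⟩ = gaussian Q (w 0) (momentVector Q ⟨n, Fin.tail w⟩) := by
      have := gaussianMonomial_cons Q (w 0) ⟨n, Fin.tail w⟩
      rw [Word.cons, Fin.cons_self_tail] at this
      rw [momentVector, this]; rfl
    rw [h, pow_succ']
    refine (ContinuousLinearMap.le_opENorm _ _).trans (mul_le_mul' ?_ (ih _))
    rw [← ofReal_norm]
    exact ENNReal.ofReal_le_ofReal (hR _)

variable {Q} in
theorem Fock.clm_ext {S T : Fock Q →L[ℂ] Fock Q} (h : ∀ u, S (tensor Q u) = T (tensor Q u)) :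
    S = T := by
  ext x
  induction x using UniformSpace.Completion.induction_on with
  | hp => exact isClosed_eq (by fun_prop) (by fun_prop)
  | ih x =>
    refine PreFock.induction x ?_ (fun x y hx hy => ?_) fun a u => ?_
    · rw [UniformSpace.Completion.coe_zero, map_zero, map_zero]
    · rw [UniformSpace.Completion.coe_add, map_add, map_add, hx, hy]
    · rw [UniformSpace.Completion.coe_smul, map_smul, map_smul]
      exact congrArg (a • ·) (h u)

theorem DeformationMatrix.abs_coeff_le_maxAbs (i j : Fin N) : |Q.coeff i j| ≤ Q.maxAbs :=
  le_ciSup (f := fun p : Fin N × Fin N => |Q.coeff p.1 p.2|) (Set.finite_range _).bddAbove (i, j)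

theorem DeformationMatrix.maxAbs_lt_one [Nonempty (Fin N)] : Q.maxAbs < 1 := by
  obtain ⟨p, hp⟩ := exists_eq_ciSup_of_finite (f := fun p : Fin N × Fin N => |Q.coeff p.1 p.2|)
  rw [DeformationMatrix.maxAbs, ← hp]
  exact Q.abs_lt_one _ _

/-! ### The double series of coefficients and its summability -/

theorem tsum_enorm_smul_mul (r : ℝ≥0∞) (c : ℂ) (ψ φ : Word N → ℂ) :
    ∑' p : Word N × Word N, ‖c * ψ p.1 * (starRingEnd ℂ) (φ p.2)‖ₑ * r ^ (p.1.1 + p.2.1) =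
      ‖c‖ₑ * seriesNorm r ψ * seriesNorm r φ := by
  rw [ENNReal.tsum_prod', show seriesNorm r ψ = ∑' w, ‖ψ w‖ₑ * r ^ w.1 from rfl,
    ← ENNReal.tsum_mul_left, ← ENNReal.tsum_mul_right]
  refine tsum_congr fun u => ?_
  rw [seriesNorm, ← ENNReal.tsum_mul_left]
  refine tsum_congr fun v => ?_
  rw [enorm_mul, enorm_mul, RCLike.enorm_conj, pow_add]
  ring

/-- Only finitely many terms are nonzero. The conjugate on the coefficients of `φ` appears because a
rank one operator is conjugate linear in its second vector. -/
theorem hasSum_rankOne_momentVector (c : ℂ) (ψ φ : Word N →₀ ℂ) :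
    HasSum (fun p : Word N × Word N => (c * ψ p.1 * (starRingEnd ℂ) (φ p.2)) •
      InnerProductSpace.rankOne ℂ (momentVector Q p.1) (momentVector Q p.2))
      (c • InnerProductSpace.rankOne ℂ (Finsupp.linearCombination ℂ (momentVector Q) ψ)
        (Finsupp.linearCombination ℂ (momentVector Q) φ)) := by
  have h : c • InnerProductSpace.rankOne ℂ (Finsupp.linearCombination ℂ (momentVector Q) ψ)
        (Finsupp.linearCombination ℂ (momentVector Q) φ) =
      ∑ p ∈ ψ.support ×ˢ φ.support, (c * ψ p.1 * (starRingEnd ℂ) (φ p.2)) •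
        InnerProductSpace.rankOne ℂ (momentVector Q p.1) (momentVector Q p.2) := by
    rw [Finset.sum_product]
    simp only [Finsupp.linearCombination_apply, Finsupp.sum, map_sum, map_smul, map_smulₛₗ,
      sum_apply, smul_apply, Finset.smul_sum, smul_smul]
    rw [Finset.sum_comm]
    refine Finset.sum_congr rfl fun u _ => Finset.sum_congr rfl fun v _ => ?_
    congr 1
    ring
  rw [h]
  refine hasSum_sum_of_ne_finset_zero fun p hp => ?_
  rw [Finset.mem_product, not_and_or, Finsupp.notMem_support_iff, Finsupp.notMem_support_iff] at hp
  rcases hp with hp | hp <;> simp [hp]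

variable {Q} in
theorem enorm_letterWeight_le {q : ℝ} (hq : ∀ i j, |Q.coeff i j| ≤ q) (h0 : 0 ≤ q) (i : Fin N)
    (u : Word N) : ‖(letterWeight Q i u : ℂ)‖ₑ ≤ ENNReal.ofReal q ^ u.1 := by
  rw [← ofReal_norm, Complex.norm_real, Real.norm_eq_abs, ← ENNReal.ofReal_pow h0, letterWeight,
    Finset.abs_prod]
  refine ENNReal.ofReal_le_ofReal ?_
  calc _ ≤ ∏ _k : Fin u.1, q :=
        Finset.prod_le_prod (fun _ _ => abs_nonneg _) fun k _ => hq _ _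
    _ = _ := by simp

theorem tsum_word_pow (t : ℝ≥0∞) : ∑' u : Word N, t ^ u.1 = ∑' n : ℕ, (N * t) ^ n := by
  rw [ENNReal.tsum_sigma']
  refine tsum_congr fun n => ?_
  simp [tsum_fintype, mul_pow]

/-- The term `q_i(u) ψ_u ⊗ φ_u`, where `ψ_u` is the Wick polynomial of `u`. -/
def multiplierTerm (i : Fin N) (φ : Word N → Word N →₀ ℂ) (u : Word N) : BiSeries N := fun p =>
  (letterWeight Q i u : ℂ) * wick Q u.1 u.2 p.1 * (starRingEnd ℂ) (φ u p.2)

/-- The sum over all words `u` of the terms `q_i(u) ψ_u ⊗ (φ_u^*)°`. It represents `Ξ_i` if the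
vectors `φ_u Ω` are dual to the elementary tensors. -/
def multiplierSeries (i : Fin N) (φ : Word N → Word N →₀ ℂ) : BiSeries N := fun p =>
  ∑' u, multiplierTerm Q i φ u (p.1, Word.reverse p.2)

-- The factor `q K s^2`, with `s = r + 1/(1-q)`, collects per letter `q` from the eigenvalue of
-- `Ξ_i`, `s` from the Wick polynomial and `K s` from its dual.
variable {Q} in
theorem rNorm_multiplierTerm_le {q r K : ℝ} (hq : ∀ i j, |Q.coeff i j| ≤ q) (h0 : 0 ≤ q)
    (h1 : q < 1) (hr : 0 ≤ r) (hK : 0 ≤ K) {φ : Word N → Word N →₀ ℂ}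
    (hφ : ∀ u, seriesNorm (ENNReal.ofReal r) (φ u) ≤
      (ENNReal.ofReal K * ENNReal.ofReal (r + (1 - q)⁻¹)) ^ u.1) (i : Fin N) (u : Word N) :
    (multiplierTerm Q i φ u).rNorm r ≤ ENNReal.ofReal (q * K * (r + (1 - q)⁻¹) ^ 2) ^ u.1 := by
  have hs : 0 ≤ (1 - q)⁻¹ := inv_nonneg.2 (by linarith)
  rw [BiSeries.rNorm]
  refine (tsum_enorm_smul_mul _ _ _ _).le.trans ?_
  calc _ ≤ ENNReal.ofReal q ^ u.1 * ENNReal.ofReal (r + (1 - q)⁻¹) ^ u.1 *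
        (ENNReal.ofReal K * ENNReal.ofReal (r + (1 - q)⁻¹)) ^ u.1 := by
        gcongr
        · exact enorm_letterWeight_le hq h0 i u
        · exact seriesNorm_wick_le hq h0 h1 hr _ _
        · exact hφ u
    _ = _ := by
        rw [ENNReal.ofReal_mul (by positivity), ENNReal.ofReal_mul h0,
          ENNReal.ofReal_pow (by positivity)]
        ring

/-- Reversal permutes words without changing their length, so it leaves the weights alone; the rest
is the triangle inequality and an exchange of nonnegative sums. -/
theorem rNorm_reverse_tsum_le (r : ℝ) (G : Word N → BiSeries N) :
    BiSeries.rNorm (fun p => ∑' u, G u (p.1, Word.reverse p.2)) r ≤ ∑' u, (G u).rNorm r := by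
  simp only [BiSeries.rNorm]
  rw [ENNReal.tsum_comm, ← ((Equiv.refl (Word N)).prodCongr Word.reverse).tsum_eq
    (fun p => ∑' u, ‖G u p‖ₑ * ENNReal.ofReal r ^ (p.1.1 + p.2.1))]
  refine ENNReal.tsum_le_tsum fun p => ?_
  rw [ENNReal.tsum_mul_right]
  exact mul_le_mul_left enorm_tsum_le_tsum_enorm _

/-- Fixing a pair of words leaves a fixed weight, which can be cancelled because `r > 0`. This makes
the coefficients of `multiplierSeries` genuine sums rather than default values of `tsum`. -/
theorem summable_of_tsum_rNorm_ne_top {r : ℝ} (hr : 0 < r) {G : Word N → BiSeries N}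
    (hG : ∑' u, (G u).rNorm r ≠ ⊤) (p : Word N × Word N) : Summable fun u => G u p := by
  have h1 : (∑' u, ‖G u p‖ₑ) * ENNReal.ofReal r ^ (p.1.1 + p.2.1) ≤ ∑' u, (G u).rNorm r := by
    rw [← ENNReal.tsum_mul_right]
    exact ENNReal.tsum_le_tsum fun u => ENNReal.le_tsum
      (f := fun p => ‖G u p‖ₑ * ENNReal.ofReal r ^ (p.1.1 + p.2.1)) p
  have h2 : ∑' u, ‖G u p‖ₑ ≠ ⊤ := by
    intro h
    rw [h, ENNReal.top_mul (pow_ne_zero _ (by simpa using hr))] at h1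
    exact hG (top_le_iff.1 h1)
  exact Summable.of_enorm h2

variable {Q} in
theorem summable_multiplierTerm_smul {R : ℝ} (hR : ∀ i, ‖gaussian Q i‖ ≤ R)
    {φ : Word N → Word N →₀ ℂ} (i : Fin N) (hG : ∑' u, (multiplierTerm Q i φ u).rNorm R ≠ ⊤) :
    Summable fun x : Word N × (Word N × Word N) => multiplierTerm Q i φ x.1 x.2 •
      InnerProductSpace.rankOne ℂ (momentVector Q x.2.1) (momentVector Q x.2.2) := by
  refine Summable.of_enorm (ne_top_of_le_ne_top hG ?_)
  rw [ENNReal.tsum_prod']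
  refine ENNReal.tsum_le_tsum fun u => ENNReal.tsum_le_tsum fun p => ?_
  rw [enorm_smul, InnerProductSpace.enorm_rankOne, pow_add]
  exact mul_le_mul' le_rfl
    (mul_le_mul' (enorm_momentVector_le hR _) (enorm_momentVector_le hR _))

/-! ### Identification of the sum with the multiplier -/

-- Bounded operators are determined by their values on elementary tensors, and on `e_v` duality
-- leaves only the term `u = v`, the eigenvalue equation of `Ξ_i`.
variable {Q} in
theorem eq_multiplier_of_hasSum {i : Fin N} {φ : Word N → Fock Q}
    (hφ : ∀ u v, inner ℂ (φ u) (tensor Q v) = if u = v then 1 else 0) {T : Fock Q →L[ℂ] Fock Q}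
    (hT : HasSum (fun u => (letterWeight Q i u : ℂ) •
      InnerProductSpace.rankOne ℂ (tensor Q u) (φ u)) T) : T = multiplier Q i := by
  refine Fock.clm_ext fun v => ?_
  refine (hT.mapL (ContinuousLinearMap.apply ℂ (Fock Q) (tensor Q v))).unique ?_
  have h3 : multiplier Q i (tensor Q v) = (letterWeight Q i v : ℂ) • tensor Q v :=
    multiplier_tensor Q i v
  rw [h3]
  convert hasSum_single v ?_ using 1
  · simp [hφ]
  · intro u hu
    simp [hφ, hu]

-- Absolute summability over all triples allows the sum to be grouped by `u`; each group is the rank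
-- one operator built from `e_u` and its dual vector.
variable {Q} in
theorem hasSum_multiplierTerm_smul {R : ℝ} (hR : ∀ i, ‖gaussian Q i‖ ≤ R)
    {φ : Word N → Word N →₀ ℂ}
    (hφ : ∀ u v, inner ℂ (Finsupp.linearCombination ℂ (momentVector Q) (φ u)) (tensor Q v) =
        if u = v then 1 else 0) (i : Fin N)
    (hG : ∑' u, (multiplierTerm Q i φ u).rNorm R ≠ ⊤) :
    HasSum (fun x : Word N × (Word N × Word N) => multiplierTerm Q i φ x.1 x.2 •
      InnerProductSpace.rankOne ℂ (momentVector Q x.2.1) (momentVector Q x.2.2))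
      (multiplier Q i) := by
  have hg := summable_multiplierTerm_smul hR i hG
  have h1 := hg.hasSum.prod_fiberwise fun u => by
    have := hasSum_rankOne_momentVector Q (letterWeight Q i u) (wick Q u.1 u.2) (φ u)
    rw [linearCombination_wick] at this
    exact this
  rw [← eq_multiplier_of_hasSum hφ h1]
  exact hg.hasSum

/-- Regroups the same double sum by pairs of words instead of by `u`, producing one coefficient per
monomial; `e` serves for the reversal of the second word. -/
theorem hasSum_tsum_smul {α β γ E : Type*} [NormedAddCommGroup E] [NormedSpace ℂ E]
    {c : α → β → ℂ} {V : β → E} {T : E} (h : HasSum (fun x : α × β => c x.1 x.2 • V x.2) T)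
    (hc : ∀ p, Summable fun u => c u p) (e : γ ≃ β) :
    HasSum (fun p => (∑' u, c u (e p)) • V (e p)) T := by
  have h1 : HasSum (fun x : β × α => c x.2 x.1 • V x.1) T :=
    (Equiv.hasSum_iff (f := fun x : α × β => c x.1 x.2 • V x.2) (Equiv.prodComm β α)).2 h
  have h2 : HasSum (fun p => (∑' u, c u p) • V p) T :=
    h1.prod_fiberwise fun p => (hc p).hasSum.smul_const (V p)
  exact (Equiv.hasSum_iff (f := fun p => (∑' u, c u p) • V p) e).2 h2

variable {Q} in
theorem hasSum_multiplierSeries {R : ℝ} (hR0 : 0 < R) (hR : ∀ i, ‖gaussian Q i‖ ≤ R)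
    {φ : Word N → Word N →₀ ℂ}
    (hφ : ∀ u v, inner ℂ (Finsupp.linearCombination ℂ (momentVector Q) (φ u)) (tensor Q v) =
        if u = v then 1 else 0) (i : Fin N)
    (hG : ∑' u, (multiplierTerm Q i φ u).rNorm R ≠ ⊤) :
    HasSum (fun p : Word N × Word N => multiplierSeries Q i φ p •
      InnerProductSpace.rankOne ℂ (momentVector Q p.1) (momentVector Q (Word.reverse p.2)))
      (multiplier Q i) :=
  hasSum_tsum_smul (c := multiplierTerm Q i φ)
    (V := fun p : Word N × Word N =>
      InnerProductSpace.rankOne ℂ (momentVector Q p.1) (momentVector Q p.2))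
    (hasSum_multiplierTerm_smul hR hφ i hG) (summable_of_tsum_rNorm_ne_top hR0 hG)
    ((Equiv.refl (Word N)).prodCongr Word.reverse)

-- The bound `‖X_w Ω‖ ≤ R^{|w|}` turns finiteness of `‖F‖_R` into summability of the Hilbert–Schmidt
-- norms; the operator-norm sum only identifies the limit.
variable {Q} in
theorem represents_of_hasSum {R : ℝ} (hR : ∀ i, ‖gaussian Q i‖ ≤ R) {F : BiSeries N}
    (hF : F.rNorm R ≠ ⊤) {T : Fock Q →L[ℂ] Fock Q}
    (h : HasSum (fun p : Word N × Word N => F p •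
      InnerProductSpace.rankOne ℂ (momentVector Q p.1) (momentVector Q (Word.reverse p.2))) T) :
    F.Represents T := by
  have hop : ∀ p : Word N × Word N,
      F p • tensorOp Q (gaussianMonomial Q p.1) (gaussianMonomial Q p.2) =
      InnerProductSpace.rankOne ℂ (F p • momentVector Q p.1)
        (momentVector Q (Word.reverse p.2)) := by
    intro p
    rw [tensorOp, adjoint_gaussianMonomial, map_smul]
    rfl
  simp only [BiSeries.Represents, hop]
  refine tendsto_hsNorm_sub_sum (by simpa using h) (ne_top_of_le_ne_top hF ?_)
  refine ENNReal.tsum_le_tsum fun p => ?_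
  rw [enorm_smul, pow_add, mul_assoc]
  gcongr
  · exact enorm_momentVector_le hR _
  · exact enorm_momentVector_le hR (Word.reverse p.2)

/-! ### The distance to `1 ⊗ 1°` -/

theorem multiplierTerm_empty (i : Fin N) {φ : Word N → Word N →₀ ℂ}
    (hφ : φ ⟨0, Fin.elim0⟩ = Finsupp.single ⟨0, Fin.elim0⟩ 1) :
    multiplierTerm Q i φ ⟨0, Fin.elim0⟩ = BiSeries.unit N := by
  funext p
  obtain ⟨u, v⟩ := p
  simp only [multiplierTerm, hφ, wick, letterWeight, BiSeries.unit, Finsupp.single_apply,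
    Pi.single_apply, Prod.mk.injEq]
  by_cases hu : u = ⟨0, Fin.elim0⟩ <;> by_cases hv : v = ⟨0, Fin.elim0⟩ <;>
    simp [hu, hv, eq_comm]

theorem Word.eq_empty_iff (u : Word N) : u = ⟨0, Fin.elim0⟩ ↔ u.1 = 0 := by
  constructor
  · rintro rfl; rfl
  · obtain ⟨n, u⟩ := u
    rintro rfl
    exact congrArg _ (Subsingleton.elim _ _)

theorem tsum_word_pow_pos (t : ℝ≥0∞) :
    ∑' u : Word N, (if u = ⟨0, Fin.elim0⟩ then 0 else t ^ u.1) = N * t * ∑' n : ℕ, (N * t) ^ n := by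
  simp only [Word.eq_empty_iff]
  rw [ENNReal.tsum_sigma', tsum_eq_zero_add' ENNReal.summable,
    ← ENNReal.tsum_mul_left]
  simp only [if_true, Nat.add_eq_zero_iff, one_ne_zero, and_false, if_false, tsum_fintype,
    Finset.sum_const, Finset.card_univ, Fintype.card_fun, Fintype.card_fin, nsmul_eq_mul, mul_zero,
    zero_add]
  refine tsum_congr fun n => ?_
  push_cast
  ring

theorem BiSeries.unit_reverse (p : Word N × Word N) :
    BiSeries.unit N (p.1, Word.reverse p.2) = BiSeries.unit N p := by
  obtain ⟨u, v⟩ := p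
  have h : Word.reverse v = ⟨0, Fin.elim0⟩ ↔ v = ⟨0, Fin.elim0⟩ := by
    rw [Word.eq_empty_iff, Word.eq_empty_iff]; rfl
  simp only [BiSeries.unit, Pi.single_apply, Prod.mk.injEq, h]

/-- The term of the empty word is exactly the unit, so subtracting it removes the constant term of
the dominating geometric series. -/
theorem rNorm_multiplierSeries_sub_unit_le {r : ℝ} (hr : 0 < r) (i : Fin N)
    {φ : Word N → Word N →₀ ℂ} (hφ : φ ⟨0, Fin.elim0⟩ = Finsupp.single ⟨0, Fin.elim0⟩ 1)
    {t : ℝ≥0∞} (hG : ∀ u, (multiplierTerm Q i φ u).rNorm r ≤ t ^ u.1)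
    (ht : ∑' u, (multiplierTerm Q i φ u).rNorm r ≠ ⊤) :
    BiSeries.rNorm (multiplierSeries Q i φ - BiSeries.unit N) r ≤
      N * t * ∑' n : ℕ, (N * t) ^ n := by
  have h : multiplierSeries Q i φ - BiSeries.unit N = fun p => ∑' u : Word N,
      (if u = ⟨0, Fin.elim0⟩ then 0 else multiplierTerm Q i φ u) (p.1, Word.reverse p.2) := by
    funext p
    rw [Pi.sub_apply, multiplierSeries,
      (summable_of_tsum_rNorm_ne_top hr ht _).tsum_eq_add_tsum_ite ⟨0, Fin.elim0⟩,
      multiplierTerm_empty Q i hφ, BiSeries.unit_reverse, add_sub_cancel_left]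
    refine tsum_congr fun u => ?_
    split_ifs <;> rfl
  rw [h, ← tsum_word_pow_pos]
  refine (rNorm_reverse_tsum_le r _).trans (ENNReal.tsum_le_tsum fun u => ?_)
  split_ifs
  · simp [BiSeries.rNorm]
  · exact hG u

/-! ### The constants and the conclusion -/

theorem tsum_geometric_ofReal {t : ℝ} (h0 : 0 ≤ t) (h1 : t < 1) :
    ∑' n : ℕ, ENNReal.ofReal t ^ n = ENNReal.ofReal (1 - t)⁻¹ := by
  rw [ENNReal.tsum_geometric, ← ENNReal.ofReal_one, ← ENNReal.ofReal_sub _ h0,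
    ENNReal.ofReal_inv_of_pos (by linarith)]

variable {Q} in
theorem exists_multiplier_series {ε q R : ℝ} (hε : 0 < ε)
    (hq : q = Q.maxAbs) (hR : R = (2 + ε) / (1 - q))
    (h : q * (3 - 2 * q + (3 + ε) ^ 2 * (N : ℝ) ^ 2) < 1) (i : Fin N) :
    ‖gaussian Q i‖ < R ∧
      ∃ F : BiSeries N,
        ENNReal.ofReal R < F.radius ∧
        F.Represents (multiplier Q i) ∧
        BiSeries.rNorm (F - BiSeries.unit N) R ≤
          ENNReal.ofReal (q * (N : ℝ) ^ 2 * (3 + ε) ^ 2 /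
            (1 - q * (3 - 2 * q + (3 + ε) ^ 2 * (N : ℝ) ^ 2))) := by
  have hQ : ∀ j k, |Q.coeff j k| ≤ q := fun j k => hq ▸ Q.abs_coeff_le_maxAbs j k
  have : Nonempty (Fin N) := ⟨i⟩
  have q0 : 0 ≤ q := (abs_nonneg _).trans (hQ i i)
  have q1 : q < 1 := hq ▸ Q.maxAbs_lt_one
  have hN : (1 : ℝ) ≤ N := by exact_mod_cast i.pos
  have hN2 : (N : ℝ) ≤ (N : ℝ) ^ 2 := le_self_pow₀ hN two_ne_zero
  -- Since `(3+ε)^2 N^2 ≥ 9` and `q < 1`, the hypothesis gives even `10 q < 1`.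
  have q2 : q < 1 / 2 := by
    have h9 : 9 * 1 ≤ (3 + ε) ^ 2 * (N : ℝ) ^ 2 :=
      mul_le_mul (by nlinarith) (hN.trans hN2) zero_le_one (by positivity)
    nlinarith
  have hs : 0 < 1 - q := by linarith
  have hb : 0 < 1 - 2 * q := by linarith
  have hR0 : 0 < R := by rw [hR]; positivity
  set K := (1 - q * (1 - q)⁻¹)⁻¹ with hK
  have hK' : K = (1 - q) / (1 - 2 * q) := by
    rw [hK, show 1 - q * (1 - q)⁻¹ = (1 - 2 * q) / (1 - q) by field_simp; ring, inv_div]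
  have hK0 : 0 ≤ K := by rw [hK']; positivity
  obtain ⟨φ, hφ, hφ0, hφr⟩ := exists_dual_wick hQ q0 q2
  -- The ratio of the dominating geometric series; the factor `N` counts the choices of each letter.
  let t : ℝ → ℝ := fun r => N * (q * K * (r + (1 - q)⁻¹) ^ 2)
  have t0 : ∀ r, 0 ≤ t r := fun r => by positivity
  have hterm : ∀ r, 0 ≤ r → ∀ u, (multiplierTerm Q i φ u).rNorm r ≤
      ENNReal.ofReal (q * K * (r + (1 - q)⁻¹) ^ 2) ^ u.1 := fun r hr u =>
    rNorm_multiplierTerm_le hQ q0 q1 hr hK0 (hφr r hr) i u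
  have hNt : ∀ r, N * ENNReal.ofReal (q * K * (r + (1 - q)⁻¹) ^ 2) = ENNReal.ofReal (t r) :=
    fun r => by rw [ENNReal.ofReal_mul (Nat.cast_nonneg _), ENNReal.ofReal_natCast]
  have hfin : ∀ r, 0 ≤ r → t r < 1 → ∑' u, (multiplierTerm Q i φ u).rNorm r ≠ ⊤ := by
    intro r hr ht
    refine ne_top_of_le_ne_top ?_ (ENNReal.tsum_le_tsum (hterm r hr))
    rw [tsum_word_pow, hNt, tsum_geometric_ofReal (t0 r) ht]
    exact ENNReal.ofReal_ne_top
  have hrfin : ∀ r, 0 ≤ r → t r < 1 → (multiplierSeries Q i φ).rNorm r < ⊤ := fun r hr ht =>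
    (rNorm_reverse_tsum_le r _).trans_lt (hfin r hr ht).lt_top
  set y := q * (N : ℝ) ^ 2 * (3 + ε) ^ 2 with hy
  have hy0 : 0 ≤ y := by positivity
  -- Writing the denominator as `(1-q)(1-2q) - y` shows that the hypothesis says `y/((1-q)(1-2q)) <
  -- 1`.
  have hd : 1 - q * (3 - 2 * q + (3 + ε) ^ 2 * (N : ℝ) ^ 2) = (1 - q) * (1 - 2 * q) - y := by
    rw [hy]; ring
  have hd0 : 0 < (1 - q) * (1 - 2 * q) - y := by rw [← hd]; linarith
  -- At `r = R` one has `R + 1/(1-q) = (3+ε)/(1-q)`. The estimate only needs one factor `N`; it is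
  -- weakened to the `N^2` in `y`.
  have htR : t R ≤ y / ((1 - q) * (1 - 2 * q)) := by
    have : t R = q * N * (3 + ε) ^ 2 / ((1 - q) * (1 - 2 * q)) := by
      simp only [t, hR, hK']
      field_simp
      ring
    rw [this, hy]
    gcongr
  have htR1 : t R < 1 := htR.trans_lt ((div_lt_one (by positivity)).2 (by linarith))
  have hX : ∀ j, ‖gaussian Q j‖ < R := fun j => (norm_gaussian_le hQ q1 j).trans_lt (by
    rw [hR, ← div_eq_mul_inv]; gcongr; linarith)
  refine ⟨hX i, multiplierSeries Q i φ, ?_, ?_, ?_⟩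
  · have hcont : Continuous t := by fun_prop
    have hev : ∀ᶠ r in nhdsWithin R (Set.Ioi R), t r < 1 :=
      nhdsWithin_le_nhds (hcont.continuousAt.eventually_lt_const htR1)
    obtain ⟨r, hr1, hr⟩ := (hev.and self_mem_nhdsWithin).exists
    have hr : R < r := hr
    refine lt_of_lt_of_le ((ENNReal.ofReal_lt_ofReal_iff (hR0.trans hr)).2 hr) ?_
    exact le_iSup₂_of_le r (hrfin r (hR0.trans hr).le hr1) le_rfl
  · exact represents_of_hasSum (fun j => (hX j).le) (hrfin R hR0.le htR1).ne
      (hasSum_multiplierSeries hR0 (fun j => (hX j).le) hφ i (hfin R hR0.le htR1))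
  · refine (rNorm_multiplierSeries_sub_unit_le Q hR0 i hφ0 (hterm R hR0.le)
      (hfin R hR0.le htR1)).trans ?_
    rw [hNt, tsum_geometric_ofReal (t0 R) htR1, ← ENNReal.ofReal_mul (t0 R), hd]
    refine ENNReal.ofReal_le_ofReal ?_
    -- Monotonicity of `t/(1-t)`: from `t ≤ y/D` with `D = (1-q)(1-2q)` follows `t/(1-t) ≤ y/(D-y)`.
    rw [← div_eq_mul_inv, div_le_div_iff₀ (by linarith) hd0]
    rw [le_div_iff₀ (by positivity)] at htR
    nlinarith

end MixedQGaussian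

end

theorem lemma3p3 (N : ℕ) (Q : MixedQGaussian.DeformationMatrix N) (ε q R : ℝ) (hε : 0 < ε)
    (hq : q = Q.maxAbs) (hR : R = (2 + ε) / (1 - q))
    (h : q * (3 - 2 * q + (3 + ε) ^ 2 * (N : ℝ) ^ 2) < 1) (i : Fin N) :
    ‖MixedQGaussian.gaussian Q i‖ < R ∧
      ∃ F : MixedQGaussian.BiSeries N,
        ENNReal.ofReal R < F.radius ∧
        F.Represents (MixedQGaussian.multiplier Q i) ∧
        MixedQGaussian.BiSeries.rNorm (F - MixedQGaussian.BiSeries.unit N) R ≤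
          ENNReal.ofReal (q * (N : ℝ) ^ 2 * (3 + ε) ^ 2 /
            (1 - q * (3 - 2 * q + (3 + ε) ^ 2 * (N : ℝ) ^ 2))) := by
  exact MixedQGaussian.exists_multiplier_series hε hq hR h i
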